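/- Setting. Let $G=(V,E)$ be a finite acyclic directed multigraph (a network) whose edges (channels) have unit capacity, with one source node $s$, a set $T\subseteq V\setminus\{s\}$ of sink nodes, and internal nodes $J=V\setminus(\{s\}\cup T)$; $s$ has no incoming channels and sinks have no outgoing channels. For $t\in T$ let $C_t$ be the minimum number of channels whose removal disconnects $s$ from $t$. Let $\mathcal F$ be a finite field and $w\ge 1$ an integer (the information rate) with $w\le C_t$ for all $t\in T$, and put $\delta_t=C_t-w$. Write $In(s)=\{d_1',\dots,d_w'\}$ for the $w$ imaginary message channels entering $s$ and $In(i)$ for the set of incoming channels of a node $i\neq s$. A linear network error correction code of rate $w$ over $\mathcal F$ is a choice of coefficients $k_{d,e}\in\mathcal F$ for all $e\in E$, $d\in In(\mathrm{tail}(e))$. Its extended global encoding kernels are the vectors $\tilde f_e\in\mathcal F^{In(s)\cup E}$, $e\in E$, determined by $\tilde f_{d_i'}=1_{d_i'}$ and $\tilde f_e=\sum_{d\in In(\mathrm{tail}(e))}k_{d,e}\tilde f_d+1_e$, where $1_x$ is the indicator vector of $x$. For $t\in T$ let $\tilde F_t=(\tilde f_e: e\in In(t))$. An error pattern is a set $\rho\subseteq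 E$; put $\Phi(t)=\{(X,0)\tilde F_t: X\in\mathcal F^w\}$ and $\Delta(t,\rho)=\{(0,Z)\tilde F_t: Z\in\mathcal F^E,\ Z_e=0 \text{ for } e\notin\rho\}$. The rank $rank_t(\rho)$ is the minimum of $|\rho'|$ over all $\rho'\subseteq E$ such that $\Delta(t,\rho)\subseteq\Delta(t,\rho')$ for every such code, and $R_t(n)=\{\rho\subseteq E: |\rho|=rank_t(\rho)=n\}$. The code is regular if $\dim\Phi(t)=w$ for all $t\in T$; its minimum distance at $t$ is then $d_{\min}^{(t)}=\min\{rank_t(\rho): \dim(\Delta(t,\rho)\cap\Phi(t))>0\}$, and its degradation at $t$ is $\delta_t+1-d_{\min}^{(t)}$. Statement. Let $d$ be an integer with $0\le d\le\delta_t$ for all $t\in T$. If $$|\mathcal F|\ \ge\ \min\Big\{\sum_{t\in T}|R_t(\delta_t-d)|,\ \ 2+\Big[\sum_{t\in T}|R_t(\delta_t-d)|\tbinom{d+|J|+1}{|J|}\Big]^{\frac1{d+1}}\Big\},$$ then there exists a regular linear network error correction code of rate $w$ over $\mathcal F$ whose degradation is at most $d$ at every sink $t\in T$. Moreover, the right-hand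 side above is at most the Balli--Yan--Zhang bound $$2+\Big[\sum_{t\in T}\tbinom{|E|}{\delta_t-d}\tbinom{d+|J|+1}{|J|}\Big]^{\frac1{d+1}}.$$ -/

import Mathlib

/-- A single-source multicast network: a finite acyclic directed multigraph with nodes `V` and
unit-capacity channels `E`.  The source has no incoming channels, sinks have no outgoing ones. -/
structure Network (V E : Type*) where
  tail : E → V
  head : E → V
  source : V
  sinks : Finset V
  source_notMem_sinks : source ∉ sinks
  head_ne_source : ∀ e, head e ≠ source
  tail_notMem_sinks : ∀ e, tail e ∉ sinks
  acyclic : ∀ v, ¬ Relation.TransGen (fun a b => ∃ e, tail e = a ∧ head e = b) v v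

namespace Network

variable {V E : Type*} (G : Network V E)

/-- The incoming (real) channels of a node. -/
abbrev In (v : V) : Type _ := {e : E // G.head e = v}

/-- The internal nodes: neither the source nor a sink. -/
def internalNodes : Set V := {v | v ≠ G.source ∧ v ∉ G.sinks}

/-- `K` is a cut between `a` and `b`: no path from `a` to `b` is left after removing `K`. -/
def IsCut (a b : V) (K : Finset E) : Prop :=
  ¬ Relation.ReflTransGen (fun u v => ∃ e, e ∉ K ∧ G.tail e = u ∧ G.head e = v) a b

/-- The minimum cut capacity `C_t` between the source and `t`. -/
noncomputable def minCut (t : V) : ℕ :=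
  sInf {n | ∃ K : Finset E, G.IsCut G.source t K ∧ K.card = n}

/-- The redundancy `δ_t = C_t - w` (used for `w ≤ C_t` only). -/
noncomputable def redundancy (w : ℕ) (t : V) : ℕ := G.minCut t - w

/-- `d` is immediately upstream of `e`. -/
def Adj (d e : E) : Prop := G.head d = G.tail e

theorem transGen_adj {d e : E} (h : Relation.TransGen G.Adj d e) :
    Relation.TransGen (fun a b => ∃ e, G.tail e = a ∧ G.head e = b) (G.tail d) (G.tail e) := by
  induction h with
  | single h => exact .single ⟨d, rfl, h⟩
  | tail _ h ih => exact ih.tail ⟨_, rfl, h⟩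

theorem adj_wellFounded [Finite E] : WellFounded G.Adj := by
  have hirr : Std.Irrefl (Relation.TransGen G.Adj) :=
    ⟨fun e h => G.acyclic _ (G.transGen_adj h)⟩
  exact (Finite.wellFounded_of_trans_of_irrefl (Relation.TransGen G.Adj)).mono
    (fun _ _ h => .single h)

/-- A linear network error correction code of rate `w` over `F`, given by its local encoding
coefficients: `src i e` belongs to the `i`-th imaginary message channel into the source and to an
outgoing channel `e` of the source, `loc d e` to an adjacent pair of channels `(d, e)`.
All the other coefficients are zero. -/
structure Code (F : Type*) [Field F] (w : ℕ) where
  src : Fin w → E → F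
  loc : E → E → F
  src_eq_zero : ∀ i e, G.tail e ≠ G.source → src i e = 0
  loc_eq_zero : ∀ d e, G.head d ≠ G.tail e → loc d e = 0

namespace Code

variable {G} [Fintype E] {F : Type*} [Field F] {w : ℕ} (C : G.Code F w)

open Classical in
/-- The extended global encoding kernel of a channel, with entries indexed by the `w` message
channels and by the channels in `E`.  It is defined recursively along the acyclic network by
`f e = ∑ d ∈ In (tail e), k d e • f d + 1_e`, see `Code.kernel_eq`. -/
noncomputable def kernel : E → (Fin w ⊕ E → F) :=
  G.adj_wellFounded.fix fun e f =>
    ∑ i, C.src i e • Pi.single (Sum.inl i) 1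
      + ∑ d : G.In (G.tail e), C.loc d e • f d.1 d.2
      + Pi.single (Sum.inr e) 1

open Classical in
theorem kernel_eq (e : E) :
    C.kernel e = ∑ i, C.src i e • Pi.single (Sum.inl i) 1
      + ∑ d : G.In (G.tail e), C.loc d e • C.kernel d
      + Pi.single (Sum.inr e) 1 := by
  rw [kernel, WellFounded.fix_eq]

/-- The decoding matrix at `t`, whose columns are the extended kernels of the channels into `t`. -/
noncomputable def decodingMatrix (t : V) : Matrix (Fin w ⊕ E) (G.In t) F :=
  Matrix.of fun j e => C.kernel e j

/-- The message space `Φ(t)`: all `(X, 0) F_t` with `X ∈ F^w`. -/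
noncomputable def messageSpace (t : V) : Submodule F (G.In t → F) :=
  Submodule.map (C.decodingMatrix t).vecMulLinear
    { carrier := {v | ∀ e, v (Sum.inr e) = 0}
      add_mem' := fun ha hb e => by simp [ha e, hb e]
      zero_mem' := fun _ => rfl
      smul_mem' := fun c _ ha e => by simp [ha e] }

/-- The error space `Δ(t, ρ)`: all `(0, Z) F_t` with `Z` matching the error pattern `ρ`,
that is, vanishing outside `ρ`. -/
noncomputable def errorSpace (t : V) (ρ : Finset E) : Submodule F (G.In t → F) :=
  Submodule.map (C.decodingMatrix t).vecMulLinear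
    { carrier := {v | (∀ i, v (Sum.inl i) = 0) ∧ ∀ e, e ∉ ρ → v (Sum.inr e) = 0}
      add_mem' := fun ha hb =>
        ⟨fun i => by simp [ha.1 i, hb.1 i], fun e he => by simp [ha.2 e he, hb.2 e he]⟩
      zero_mem' := ⟨fun _ => rfl, fun _ _ => rfl⟩
      smul_mem' := fun c _ ha =>
        ⟨fun i => by simp [ha.1 i], fun e he => by simp [ha.2 e he]⟩ }

/-- A code is regular if `dim Φ(t) = w` at every sink. -/
def IsRegular : Prop := ∀ t ∈ G.sinks, Module.finrank F (C.messageSpace t) = w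

end Code

section Rank

variable [Fintype E] (F : Type*) [Field F] (w : ℕ)

/-- `ρ₁` is dominated by `ρ₂` with respect to `t`: `Δ(t, ρ₁) ⊆ Δ(t, ρ₂)` for every code. -/
def Dominated (t : V) (ρ₁ ρ₂ : Finset E) : Prop :=
  ∀ C : G.Code F w, C.errorSpace t ρ₁ ≤ C.errorSpace t ρ₂

/-- The rank of an error pattern: the least size of an error pattern dominating it. -/
noncomputable def rank (t : V) (ρ : Finset E) : ℕ :=
  sInf {n | ∃ ρ' : Finset E, G.Dominated F w t ρ ρ' ∧ ρ'.card = n}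

/-- `R_t(n)`: the error patterns `ρ` with `|ρ| = rank_t(ρ) = n`. -/
def fullRankPatterns (t : V) (n : ℕ) : Set (Finset E) :=
  {ρ | ρ.card = n ∧ G.rank F w t ρ = n}

end Rank

namespace Code

variable {G} [Fintype E] {F : Type*} [Field F] {w : ℕ} (C : G.Code F w)

/-- The minimum distance of a (regular) code at `t`: the least rank of an error pattern whose error
space meets the message space nontrivially.  For a regular code of rate `w ≥ 1` and a sink `t`
such a pattern exists, for example the set of all channels. -/
noncomputable def minDist (t : V) : ℕ :=
  sInf {n | ∃ ρ : Finset E,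
    0 < Module.finrank F ↥(C.errorSpace t ρ ⊓ C.messageSpace t) ∧ G.rank F w t ρ = n}

/-- The degradation `δ_t + 1 - d_min` of a code at `t`. -/
noncomputable def degradation (t : V) : ℤ := (G.redundancy w t : ℤ) + 1 - C.minDist t

end Code

end Network

/-! The row of a channel in the decoding matrix at `t` is a combination, with that channel's own
coefficients, of the rows of the channels immediately downstream; channels into a sink have unit
vectors as rows (`kernel_backward`, `decodingMatrix_of_sink`). Coefficients can therefore be chosen
from the sinks back to the source, each choice leaving the rows further downstream intact.

A set of channels separating `ρ` from `t` dominates `ρ`. Hence Menger's theorem links a full-rank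
pattern to `t` by disjoint paths, together with paths from the source as long as the total does not
exceed `C_t` (`card_le_of_separates`, `exists_leveled_linking`). Every pattern of rank at most `δ_t
- d` is dominated by a member of `R_t(δ_t - d)`, so it suffices that for each pair `(t, ρ)` with `ρ`
in this set no nonzero message lands in `Δ(t, ρ)`.

First bound: for each pair take `w + |ρ|` paths and keep the rows at the current fronts of the paths
independent. Moving back over one channel, each pair forbids at most one proper subspace of
coefficient vectors, and `q` proper subspaces do not cover a space over a field of `q` elements
(`exists_code_linearIndependent`).

Second bound: take `w + d + |ρ| = C_t` paths, so that a rank loss of `d` is harmless, and draw the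
coefficients at random, node by node. At an internal node the rank drops by `x` with probability at
most `(q - 1)⁻ˣ`; at the source an excess `a - 1` of the rank over `w + |ρ|` gives failure
probability at most `(q - 1)⁻ᵃ`. With `j` internal nodes to go, the risk is measured by the
potential `(a + j).choose j / (q - 1)ᵃ`, which does not grow on average (`sum_potential_le`). Its
sum over all pairs starts below 1, and some draw at each node does not increase it. -/

open Relation

/-! ### Topological numberings and Menger's theorem -/

/-- A finite acyclic relation admits an injective topological numbering by `0, …, |α| - 1`. -/
theorem exists_topological_numbering {α : Type*} [Fintype α] (r : α → α → Prop)
    (hr : ∀ a, ¬ TransGen r a a) :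
    ∃ τ : α → ℕ, Function.Injective τ ∧ (∀ a, τ a < Fintype.card α) ∧
      ∀ a b, r a b → τ a < τ b := by
  classical
  let below : α → Finset α := fun a => Finset.univ.filter fun b => TransGen r b a
  have hbelow : ∀ a b, r a b → (below a).card < (below b).card := by
    intro a b hab
    refine Finset.card_lt_card (Finset.ssubset_iff_of_subset ?_ |>.mpr ⟨a, ?_, ?_⟩)
    · intro c hc
      simp only [below, Finset.mem_filter, Finset.mem_univ, true_and] at hc ⊢
      exact hc.tail hab
    · simpa [below] using TransGen.single hab
    · simpa [below] using hr a
  -- Ties in the number of predecessors are broken by an arbitrary enumeration; `τ` is the position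
  -- in the resulting linear order.
  let key : α → ℕ ×ₗ Fin (Fintype.card α) :=
    fun a => toLex ((below a).card, Fintype.equivFin α a)
  have hkey : Function.Injective key := fun a b h => by
    have := congrArg (fun x => (ofLex x).2) h
    exact (Fintype.equivFin α).injective this
  let τ : α → ℕ := fun a => (Finset.univ.filter fun b => key b < key a).card
  have hτ : ∀ a b, key a < key b → τ a < τ b := by
    intro a b hab
    refine Finset.card_lt_card (Finset.ssubset_iff_of_subset ?_ |>.mpr ⟨a, ?_, ?_⟩)
    · intro c hc
      simp only [Finset.mem_filter, Finset.mem_univ, true_and] at hc ⊢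
      exact hc.trans hab
    · simpa using hab
    · simp
  refine ⟨τ, fun a b h => ?_, fun a => ?_, fun a b hab => hτ a b ?_⟩
  · by_contra hne
    rcases lt_or_gt_of_ne (hkey.ne hne) with h' | h'
    · exact (hτ _ _ h').ne h
    · exact (hτ _ _ h').ne h.symm
  · refine Finset.card_lt_univ_of_notMem (x := a) ?_
    simp
  · exact Prod.Lex.toLex_lt_toLex.mpr (Or.inl (hbelow a b hab))

/-- Menger's theorem for finite levelled digraphs: if no set smaller than `A` separates `A` from
`B`, then disjoint paths lead from all of `A` into `B`.  The paths are moved forward level by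
level: `p j` lists their first vertices of level at least `j`. -/
theorem exists_leveled_linking {M : Type*} [Fintype M] (R : M → M → Prop) (A : Finset M)
    (B : Set M) (lvl : M → ℕ) (L : ℕ) (hlt : ∀ u v, R u v → lvl u < lvl v)
    (hB : ∀ b ∈ B, lvl b = L) (hL : ∀ m, lvl m ≤ L)
    (hsep : ∀ K : Finset M, (∀ a ∈ A, ∀ b ∈ B, a ∉ K →
      ¬ ReflTransGen (fun u v => R u v ∧ v ∉ K) a b) → A.card ≤ K.card) :
    ∃ p : ℕ → A → M, (∀ a, p 0 a = a) ∧ (∀ j, Function.Injective (p j)) ∧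
      (∀ j a, p (j + 1) a = p j a ∨ lvl (p j a) = j ∧ R (p j a) (p (j + 1) a)) ∧
      (∀ j a, j ≤ L → j ≤ lvl (p j a)) ∧ ∀ a, p L a ∈ B := by
  classical
  -- A linking is read off from a matching of all vertices: `u` is matched with its successor on a
  -- path, with itself if it is unused, or with an exit `inr u` if it lies in `B`. Members of `A`
  -- are never targets, so paths start there.
  let targets : M → Finset (M ⊕ M) := fun u => Finset.univ.filter fun x =>
    (∃ v, x = Sum.inl v ∧ v ∉ A ∧ (v = u ∨ R u v)) ∨ (x = Sum.inr u ∧ u ∈ B)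
  obtain ⟨φ, hφ, hφt⟩ :=
      (Finset.all_card_le_biUnion_card_iff_exists_injective targets).mp (by
    intro S
    let N : Finset M := Finset.univ.filter fun v => v ∉ A ∧ v ∉ S ∧ ∃ u ∈ S, R u v
    -- Hall's condition for `S`: a path from `A` avoiding this set cannot leave `S`, nor end in `B`
    -- inside `S`, so the set separates. Thus `|A ∩ S| ≤ |N| + |S ∩ B|`, and `S` has the disjoint
    -- targets `S \ A`, `N` and the exits of `S ∩ B`.
    have hcut := hsep (N ∪ (S.filter fun u => u ∈ B) ∪ (A \ S)) (by
      intro a ha b hb haK hab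
      have key : ∀ c, ReflTransGen (fun u v => R u v ∧
          v ∉ N ∪ (S.filter fun u => u ∈ B) ∪ (A \ S)) a c → c ∈ S := by
        intro c hc
        induction hc with
        | refl =>
          by_contra haS
          exact haK (Finset.mem_union_right _ (by simp [ha, haS]))
        | tail _ h ih =>
          rename_i u v _
          obtain ⟨hR, hv⟩ := h
          by_contra hvS
          apply hv
          by_cases hvA : v ∈ A
          · exact Finset.mem_union_right _ (by simp [hvA, hvS])
          · exact Finset.mem_union_left _ (Finset.mem_union_left _
              (by simp only [N, Finset.mem_filter, Finset.mem_univ, true_and]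
                  exact ⟨hvA, hvS, _, ih, hR⟩))
      have hbS := key b hab
      have hbK : b ∈ N ∪ (S.filter fun u => u ∈ B) ∪ (A \ S) :=
        Finset.mem_union_left _ (Finset.mem_union_right _ (by simp [hb, hbS]))
      rcases hab.cases_tail with h | ⟨c, _, h⟩
      · exact haK (h ▸ hbK)
      · exact h.2 hbK)
    have h1 : ((S \ A ∪ N).image Sum.inl ∪ (S.filter fun u => u ∈ B).image Sum.inr :
        Finset (M ⊕ M)) ⊆ S.biUnion targets := by
      intro x hx
      simp only [Finset.mem_union, Finset.mem_image, Finset.mem_sdiff, Finset.mem_filter,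
        Finset.mem_univ, true_and, N] at hx
      simp only [Finset.mem_biUnion, targets, Finset.mem_filter, Finset.mem_univ, true_and]
      rcases hx with ⟨v, hv | ⟨hvA, _, u, hu, hR⟩, rfl⟩ | ⟨v, hv, rfl⟩
      · exact ⟨v, hv.1, Or.inl ⟨v, rfl, hv.2, Or.inl rfl⟩⟩
      · exact ⟨u, hu, Or.inl ⟨v, rfl, hvA, Or.inr hR⟩⟩
      · exact ⟨v, hv.1, Or.inr ⟨rfl, hv.2⟩⟩
    have h2 : (((S \ A ∪ N).image Sum.inl ∪ (S.filter fun u => u ∈ B).image Sum.inr :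
        Finset (M ⊕ M))).card = (S \ A).card + N.card + (S.filter fun u => u ∈ B).card := by
      rw [Finset.card_union_of_disjoint, Finset.card_image_of_injective _ Sum.inl_injective,
        Finset.card_image_of_injective _ Sum.inr_injective, Finset.card_union_of_disjoint]
      · rw [Finset.disjoint_left]
        intro x hx hx'
        simp only [Finset.mem_sdiff, Finset.mem_filter, Finset.mem_univ, true_and, N] at hx hx'
        exact hx'.2.1 hx.1
      · rw [Finset.disjoint_left]
        intro x hx hx'
        simp only [Finset.mem_image] at hx hx'
        obtain ⟨_, _, rfl⟩ := hx
        obtain ⟨_, _, h⟩ := hx'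
        exact Sum.inr_ne_inl h
    have h3 := Finset.card_le_card h1
    have h4 := Finset.card_union_le (N ∪ (S.filter fun u => u ∈ B)) (A \ S)
    have h5 := Finset.card_union_le N (S.filter fun u => u ∈ B)
    have h6 := Finset.card_sdiff_add_card_inter A S
    have h7 := Finset.card_sdiff_add_card_inter S A
    rw [Finset.inter_comm] at h7
    omega)
  have hmove : ∀ u v, φ u = Sum.inl v → v ∉ A ∧ (v = u ∨ R u v) := by
    intro u v h
    have := hφt u
    rw [h] at this
    simpa [targets] using this
  have hexit : ∀ u v, φ u = Sum.inr v → u ∈ B := by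
    intro u v h
    have := hφt u
    rw [h] at this
    simp only [targets, Finset.mem_filter, Finset.mem_univ, true_and] at this
    rcases this with ⟨_, h, _⟩ | ⟨_, h⟩
    · exact (Sum.inr_ne_inl h).elim
    · exact h
  let step : ℕ → M → M := fun j u => if lvl u = j then Sum.elim id (fun _ => u) (φ u) else u
  let p : ℕ → A → M := fun j a => Nat.rec (a : M) (fun j u => step j u) j
  have hp0 : ∀ a, p 0 a = a := fun a => rfl
  have hpS : ∀ j a, p (j + 1) a = step j (p j a) := fun j a => rfl
  have hstep : ∀ j u, step j u = u ∨ lvl u = j ∧ φ u = Sum.inl (step j u) := by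
    intro j u
    by_cases hj : lvl u = j
    · rcases h : φ u with v | v
      · right; simp [step, hj, h]
      · left; simp [step, h]
    · left; simp [step, hj]
  -- A vertex reached by a path is already the image of its predecessor, so by injectivity it is not
  -- matched with itself.
  have hused : ∀ j a, φ (p j a) ≠ Sum.inl (p j a) := by
    intro j a
    induction j with
    | zero => exact fun h => (hmove _ _ h).1 a.2
    | succ j ih =>
      rw [hpS]
      rcases hstep j (p j a) with h | ⟨_, h⟩
      · rwa [h]
      · intro h'
        have := hφ (h'.trans h.symm)
        rw [this] at h'
        exact ih h'
  have horig : ∀ j a, p j a ∈ A ∨ ∃ i < j, lvl (p i a) = i ∧ φ (p i a) = Sum.inl (p j a) := by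
    intro j a
    induction j with
    | zero => exact Or.inl a.2
    | succ j ih =>
      rw [hpS]
      rcases hstep j (p j a) with h | ⟨hl, h⟩
      · rw [h]
        rcases ih with h' | ⟨i, hi, h'⟩
        · exact Or.inl h'
        · exact Or.inr ⟨i, by omega, h'⟩
      · exact Or.inr ⟨j, by omega, hl, h⟩
  have hpstep : ∀ j a, p (j + 1) a = p j a ∨
      lvl (p j a) = j ∧ φ (p j a) = Sum.inl (p (j + 1) a) := fun j a => hstep j (p j a)
  have hR : ∀ j a v, φ (p j a) = Sum.inl v → R (p j a) v := by
    intro j a v h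
    rcases (hmove _ _ h).2 with h' | h'
    · exact (hused j a (h' ▸ h)).elim
    · exact h'
  have hlvl : ∀ j a, j ≤ L → j ≤ lvl (p j a) := by
    intro j a
    induction j with
    | zero => simp
    | succ j ih =>
      intro hj
      have ih := ih (by omega)
      by_cases h : lvl (p j a) = j
      · rcases h' : φ (p j a) with v | v
        · have hv : p (j + 1) a = v := by simp [hpS, step, h, h']
          have := hlt _ _ (hR j a v h')
          rw [hv]; omega
        · have := hB _ (hexit _ _ h')
          omega
      · have : p (j + 1) a = p j a := by simp [hpS, step, h]
        rw [this]; omega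
  refine ⟨p, hp0, ?_, ?_, hlvl, ?_⟩
  · intro j
    induction j with
    | zero => exact fun a b h => Subtype.ext h
    | succ j ih =>
      -- A path cannot step onto the waiting vertex of another path: that vertex lies in `A`, which
      -- is never a target, or is the image of a vertex of level below `j`.
      have hcross : ∀ a b, lvl (p j a) = j → φ (p j a) = Sum.inl (p (j + 1) a) →
          p (j + 1) b = p j b → p (j + 1) a = p (j + 1) b → False := by
        intro a b hl ha hb hab
        rw [hab, hb] at ha
        rcases horig j b with h | ⟨i, hi, hli, h⟩
        · exact (hmove _ _ ha).1 h
        · have := hφ (ha.trans h.symm)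
          rw [this] at hl
          omega
      intro a b hab
      rcases hpstep j a with ha | ⟨hla, ha⟩ <;> rcases hpstep j b with hb | ⟨hlb, hb⟩
      · exact ih (by rw [← ha, ← hb, hab])
      · exact (hcross b a hlb hb ha hab.symm).elim
      · exact (hcross a b hla ha hb hab).elim
      · exact ih (hφ (by rw [ha, hb, hab]))
  · intro j a
    rcases hpstep j a with h | ⟨hl, h⟩
    · exact Or.inl h
    · exact Or.inr ⟨hl, hR j a _ h⟩
  · intro a
    have h1 := hlvl L a le_rfl
    rcases h : φ (p L a) with v | v
    · have := hlt _ _ (hR L a v h)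
      have := hL v
      omega
    · exact hexit _ _ h

/-! ### Rows of the decoding matrix and their backward recursion -/

namespace Network

variable {V E : Type*} {G : Network V E}

theorem transGen_adj_irrefl (e : E) : ¬ TransGen G.Adj e e :=
  fun h => G.acyclic _ (G.transGen_adj h)

/-- The channels, together with `n` imaginary channels into the source, upstream of a channel. -/
def ExtAdj (G : Network V E) {n : ℕ} : Fin n ⊕ E → E → Prop :=
  Sum.elim (fun _ e => G.tail e = G.source) G.Adj

namespace Code

variable {F : Type*} [Field F] {w : ℕ}

/-- All local coefficients of a code, those of the message channels included. -/
def coef (C : G.Code F w) : Fin w ⊕ E → E → F := Sum.elim C.src C.loc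

open Classical in
/-- The code with given local coefficients, where they are not forced to vanish. -/
noncomputable def ofCoef (K : Fin w ⊕ E → E → F) : G.Code F w where
  src i e := if G.tail e = G.source then K (Sum.inl i) e else 0
  loc d e := if G.head d = G.tail e then K (Sum.inr d) e else 0
  src_eq_zero _ _ h := if_neg h
  loc_eq_zero _ _ h := if_neg h

open Classical in
theorem coef_ofCoef (K : Fin w ⊕ E → E → F) (m : Fin w ⊕ E) (e : E) :
    (ofCoef (G := G) K).coef m e = if G.ExtAdj m e then K m e else 0 := by
  rcases m with i | d <;> rfl

theorem coef_eq_zero (C : G.Code F w) {m : Fin w ⊕ E} {e : E} (h : ¬ G.ExtAdj m e) :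
    C.coef m e = 0 := by
  rcases m with i | d
  · exact C.src_eq_zero i e h
  · exact C.loc_eq_zero d e h

variable [Fintype E]

theorem sum_in_smul_kernel (C : G.Code F w) (e : E) (m : Fin w ⊕ E) [Fintype (G.In (G.tail e))] :
    (∑ d : G.In (G.tail e), C.loc d e • C.kernel d) m = ∑ d, C.kernel d m * C.loc d e := by
  classical
  rw [Finset.sum_apply]
  simp only [Pi.smul_apply, smul_eq_mul]
  rw [← Finset.sum_subset (Finset.subset_univ (Finset.univ.filter fun d => G.head d = G.tail e))]
  · rw [← Finset.sum_subtype (p := fun d => G.head d = G.tail e)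
      (f := fun d => C.loc d e * C.kernel d m) (Finset.univ.filter fun d => G.head d = G.tail e)
      (by simp)]
    exact Finset.sum_congr rfl fun d _ => mul_comm _ _
  · intro d _ hd
    simp only [Finset.mem_filter, Finset.mem_univ, true_and] at hd
    rw [C.loc_eq_zero d e hd, mul_zero]

open Classical in
theorem kernel_inr (C : G.Code F w) (e d : E) :
    C.kernel e (Sum.inr d) = (∑ c, C.kernel c (Sum.inr d) * C.loc c e)
      + if d = e then 1 else 0 := by
  conv_lhs => rw [kernel_eq]
  simp only [Pi.add_apply]
  rw [sum_in_smul_kernel, Finset.sum_apply]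
  simp [Pi.single_apply]

open Classical in
theorem kernel_inl (C : G.Code F w) (e : E) (i : Fin w) :
    C.kernel e (Sum.inl i) = C.src i e + ∑ c, C.kernel c (Sum.inl i) * C.loc c e := by
  conv_lhs => rw [kernel_eq]
  simp only [Pi.add_apply]
  rw [sum_in_smul_kernel, Finset.sum_apply]
  simp [Pi.single_apply]

-- The defining recursion runs forward along the network. For square matrices a one-sided inverse is
-- two-sided, and the product in the other order is the backward recursion.
open Classical in
theorem transfer_mul (C : G.Code F w) :
    (Matrix.of fun d e => C.kernel e (Sum.inr d)) * (1 - Matrix.of C.loc) = 1 := by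
  ext d e
  rw [mul_sub, mul_one, Matrix.sub_apply, Matrix.mul_apply, Matrix.of_apply, kernel_inr]
  simp [Matrix.one_apply]

open Classical in
/-- The backward recursion of the kernels. -/
theorem kernel_backward (C : G.Code F w) (m : Fin w ⊕ E) (e : E) :
    C.kernel e m = (∑ c, C.coef m c * C.kernel e (Sum.inr c))
      + if m = Sum.inr e then 1 else 0 := by
  set T : Matrix E E F := Matrix.of fun d e => C.kernel e (Sum.inr d) with hT
  have h1 : T * (1 - Matrix.of C.loc) = 1 := C.transfer_mul
  have h2 : (1 - Matrix.of C.loc) * T = 1 := mul_eq_one_comm.mp h1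
  rcases m with i | d
  · have h3 : (Matrix.of fun i e => C.kernel e (Sum.inl i)) * (1 - Matrix.of C.loc)
        = Matrix.of C.src := by
      ext i e
      rw [Matrix.mul_sub, Matrix.mul_one, Matrix.sub_apply, Matrix.mul_apply, Matrix.of_apply,
        kernel_inl]
      simp
    have h4 : (Matrix.of fun i e => C.kernel e (Sum.inl i)) = Matrix.of C.src * T := by
      rw [← h3, Matrix.mul_assoc, h2, Matrix.mul_one]
    have h5 := congrFun (congrFun h4 i) e
    rw [Matrix.mul_apply] at h5
    simpa [coef, hT] using h5
  · have h4 : T = Matrix.of C.loc * T + 1 := by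
      rw [← h2, sub_mul, one_mul]; abel
    have h5 := congrFun (congrFun h4 d) e
    rw [Matrix.add_apply, Matrix.mul_apply] at h5
    simpa [coef, hT, Matrix.one_apply] using h5

theorem decodingMatrix_of_head_ne (C : G.Code F w) (t : V) (m : Fin w ⊕ E)
    (hm : ∀ e, G.head e = t → m ≠ Sum.inr e) :
    C.decodingMatrix t m = ∑ e, C.coef m e • C.decodingMatrix t (Sum.inr e) := by
  classical
  ext e
  rw [Finset.sum_apply]
  have := C.kernel_backward m e
  rw [if_neg (hm e e.2), add_zero] at this
  simpa [decodingMatrix] using this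

open Classical in
theorem decodingMatrix_of_sink (C : G.Code F w) {t : V} (ht : t ∈ G.sinks) (d : G.In t) :
    C.decodingMatrix t (Sum.inr d) = Pi.single d 1 := by
  ext e
  have := C.kernel_backward (Sum.inr d) e
  rw [Finset.sum_eq_zero, zero_add] at this
  · rw [decodingMatrix, Matrix.of_apply, this, Pi.single_apply]
    simp [Subtype.ext_iff, eq_comm]
  · intro c _
    rw [C.coef_eq_zero, zero_mul]
    intro h
    have h : G.head d = G.tail c := h
    exact G.tail_notMem_sinks c (by rwa [← h, d.2])

/-- The rows of the decoding matrix at and above a level depend only on the coefficients there. -/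
theorem decodingMatrix_congr (C C' : G.Code F w) (lvl : Fin w ⊕ E → ℕ)
    (hlt : ∀ m e, G.ExtAdj m e → lvl m < lvl (Sum.inr e)) (j : ℕ)
    (hcoef : ∀ m, j ≤ lvl m → C.coef m = C'.coef m) (t : V) (m : Fin w ⊕ E) (hm : j ≤ lvl m) :
    C.decodingMatrix t m = C'.decodingMatrix t m := by
  classical
  -- Induction on the distance to the highest level of a real channel; at distance 0 nothing lies
  -- downstream.
  have key : ∀ (N : ℕ) m, j ≤ lvl m → Finset.univ.sup (lvl ∘ Sum.inr) - lvl m ≤ N →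
      ∀ e, C.kernel e m = C'.kernel e m := by
    intro N
    induction N with
    | zero =>
      intro m hm hN e
      have hno : ∀ c, ¬ G.ExtAdj m c := fun c hc => by
        have h1 := hlt m c hc
        have h2 : lvl (Sum.inr c) ≤ Finset.univ.sup (lvl ∘ Sum.inr) :=
          Finset.le_sup (f := lvl ∘ Sum.inr) (Finset.mem_univ c)
        omega
      rw [kernel_backward, kernel_backward]
      simp [C.coef_eq_zero (hno _), C'.coef_eq_zero (hno _)]
    | succ N ih =>
      intro m hm hN e
      rw [kernel_backward, kernel_backward, hcoef m hm]
      congr 1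
      refine Finset.sum_congr rfl fun c _ => ?_
      by_cases hc : G.ExtAdj m c
      · have h1 := hlt m c hc
        rw [ih (Sum.inr c) (by omega) (by omega)]
      · rw [C'.coef_eq_zero hc, zero_mul, zero_mul]
  ext e
  exact key _ m hm le_rfl e

theorem mem_messageSpace (C : G.Code F w) (t : V) (y : G.In t → F) :
    y ∈ C.messageSpace t ↔
      ∃ X : Fin w → F, ∑ i, X i • C.decodingMatrix t (Sum.inl i) = y := by
  simp only [messageSpace, Submodule.mem_map, Matrix.vecMulLinear_apply]
  constructor
  · rintro ⟨v, hv, rfl⟩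
    refine ⟨fun i => v (Sum.inl i), ?_⟩
    have hv : ∀ e, v (Sum.inr e) = 0 := hv
    rw [Matrix.vecMul_eq_sum, Fintype.sum_sum_type]
    simp [hv]
  · rintro ⟨X, rfl⟩
    refine ⟨Sum.elim X 0, fun e => rfl, ?_⟩
    rw [Matrix.vecMul_eq_sum, Fintype.sum_sum_type]
    simp

theorem mem_errorSpace (C : G.Code F w) (t : V) (ρ : Finset E) (y : G.In t → F) :
    y ∈ C.errorSpace t ρ ↔
      ∃ Z : E → F, ∑ e ∈ ρ, Z e • C.decodingMatrix t (Sum.inr e) = y := by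
  classical
  simp only [errorSpace, Submodule.mem_map, Matrix.vecMulLinear_apply]
  constructor
  · rintro ⟨v, hv, rfl⟩
    obtain ⟨h1, h2⟩ : (∀ i, v (Sum.inl i) = 0) ∧ ∀ e, e ∉ ρ → v (Sum.inr e) = 0 := hv
    refine ⟨fun e => v (Sum.inr e), ?_⟩
    rw [Matrix.vecMul_eq_sum, Fintype.sum_sum_type]
    simp only [h1, zero_smul, Finset.sum_const_zero, zero_add]
    exact Finset.sum_subset (Finset.subset_univ _) fun e _ he => by rw [h2 e he, zero_smul]
  · rintro ⟨Z, rfl⟩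
    refine ⟨Sum.elim 0 fun e => if e ∈ ρ then Z e else 0, ⟨fun i => rfl, fun e he => if_neg he⟩, ?_⟩
    rw [Matrix.vecMul_eq_sum, Fintype.sum_sum_type]
    simp [ite_smul]

theorem errorSpace_eq_span (C : G.Code F w) (t : V) (ρ : Finset E) :
    C.errorSpace t ρ =
      Submodule.span F (Set.range fun e : ρ => C.decodingMatrix t (Sum.inr e)) := by
  ext y
  rw [mem_errorSpace, Submodule.mem_span_range_iff_exists_fun]
  constructor
  · rintro ⟨Z, rfl⟩
    exact ⟨fun e => Z e, Finset.sum_coe_sort ρ fun e => Z e • C.decodingMatrix t (Sum.inr e)⟩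
  · classical
    rintro ⟨c, rfl⟩
    refine ⟨fun e => if h : e ∈ ρ then c ⟨e, h⟩ else 0, ?_⟩
    rw [← Finset.sum_coe_sort ρ]
    simp

theorem finrank_errorSpace_le (C : G.Code F w) (t : V) (ρ : Finset E) :
    Module.finrank F (C.errorSpace t ρ) ≤ ρ.card := by
  rw [errorSpace_eq_span]
  simpa [Set.finrank] using finrank_range_le_card
    (R := F) (fun e : ρ => C.decodingMatrix t (Sum.inr e))

end Code

/-! ### Ranks of error patterns and separating sets -/

section Rank

variable [Fintype E] {F : Type*} [Field F] {w : ℕ}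

theorem Dominated.refl (t : V) (ρ : Finset E) : G.Dominated F w t ρ ρ := fun _ => le_rfl

theorem Dominated.rank_le {t : V} {ρ ρ' : Finset E} (h : G.Dominated F w t ρ ρ') :
    G.rank F w t ρ ≤ ρ'.card := Nat.sInf_le ⟨ρ', h, rfl⟩

theorem exists_dominated_card_eq_rank (t : V) (ρ : Finset E) :
    ∃ ρ', G.Dominated F w t ρ ρ' ∧ ρ'.card = G.rank F w t ρ :=
  Nat.sInf_mem (s := {n | ∃ ρ' : Finset E, G.Dominated F w t ρ ρ' ∧ ρ'.card = n})
    ⟨_, ρ, Dominated.refl t ρ, rfl⟩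

/-- A single code suffices to bound the rank from below; this certifies full rank. -/
theorem finrank_errorSpace_le_rank (C : G.Code F w) (t : V) (ρ : Finset E) :
    Module.finrank F (C.errorSpace t ρ) ≤ G.rank F w t ρ := by
  obtain ⟨ρ', h, hc⟩ := exists_dominated_card_eq_rank (G := G) (F := F) (w := w) t ρ
  rw [← hc]
  exact (Submodule.finrank_mono (h C)).trans (C.finrank_errorSpace_le t ρ')

/-- An error pattern is dominated by every set of channels that separates it from `t`. -/
theorem dominated_of_separates {t : V} {ρ K : Finset E}
    (h : ∀ d ∈ ρ, ∀ e, G.head e = t → d ∉ K →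
      ¬ ReflTransGen (fun u v => G.Adj u v ∧ v ∉ K) d e) : G.Dominated F w t ρ K := by
  intro C
  have key : ∀ d, (∀ e, G.head e = t → d ∉ K →
      ¬ ReflTransGen (fun u v => G.Adj u v ∧ v ∉ K) d e) →
      C.decodingMatrix t (Sum.inr d) ∈ C.errorSpace t K := by
    have hwf : WellFounded (fun a b => G.Adj b a) := by
      have hirr : Std.Irrefl (TransGen fun a b => G.Adj b a) :=
        ⟨fun e h => transGen_adj_irrefl (G := G) e (transGen_swap.mp h)⟩
      exact (Finite.wellFounded_of_trans_of_irrefl (TransGen fun a b => G.Adj b a)).mono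
        (fun _ _ h => .single h)
    intro d
    induction d using hwf.induction with
    | _ d ih =>
      intro hd
      by_cases hdK : d ∈ K
      · rw [Code.errorSpace_eq_span]
        exact Submodule.subset_span ⟨⟨d, hdK⟩, rfl⟩
      -- A separated channel outside `K` does not enter `t`, and each of its successors is again
      -- separated, so its row is a combination of rows already in the error space of `K`.
      · rw [C.decodingMatrix_of_head_ne t (Sum.inr d)]
        · refine Submodule.sum_mem _ fun e _ => ?_
          by_cases hde : G.Adj d e
          · refine Submodule.smul_mem _ _ (ih e hde fun e' he' heK hpath => ?_)
            exact hd e' he' hdK (ReflTransGen.head ⟨hde, heK⟩ hpath)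
          · rw [C.coef_eq_zero (m := Sum.inr d) hde, zero_smul]
            exact Submodule.zero_mem _
        · rintro e he hde
          cases hde
          exact hd d he hdK .refl
  rw [Code.errorSpace_eq_span C t ρ, Submodule.span_le]
  rintro _ ⟨d, rfl⟩
  exact key d (h d d.2)

omit [Fintype E] in
theorem minCut_le_card {t : V} {K : Finset E} (h : G.IsCut G.source t K) :
    G.minCut t ≤ K.card := Nat.sInf_le ⟨K, h, rfl⟩

omit [Fintype E] in
/-- A set of channels separating an imaginary message channel from `t` is a cut. -/
theorem isCut_of_separates {n : ℕ} {t : V} (ht : t ∈ G.sinks) {K : Finset (Fin n ⊕ E)}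
    (i : Fin n)
    (h : ∀ e, G.head e = t →
      ¬ ReflTransGen (fun u v => (∃ e, v = Sum.inr e ∧ G.ExtAdj u e) ∧ v ∉ K)
        (Sum.inl i) (Sum.inr e)) :
    G.IsCut G.source t (K.preimage Sum.inr Sum.inr_injective.injOn) := by
  intro hpath
  have key : ∀ v, ReflTransGen (fun u v => ∃ e, e ∉ K.preimage Sum.inr Sum.inr_injective.injOn ∧
      G.tail e = u ∧ G.head e = v) G.source v → v = G.source ∨ ∃ e, G.head e = v ∧
        ReflTransGen (fun u v => (∃ e, v = Sum.inr e ∧ G.ExtAdj u e) ∧ v ∉ K)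
          (Sum.inl i) (Sum.inr e) := by
    intro v hv
    induction hv with
    | refl => exact Or.inl rfl
    | tail _ h ih =>
      obtain ⟨e, heK, htail, hhead⟩ := h
      have heK : Sum.inr e ∉ K := by simpa using heK
      refine Or.inr ⟨e, hhead, ?_⟩
      rcases ih with hs | ⟨c, hc, hpc⟩
      · exact .single ⟨⟨e, rfl, htail.trans hs⟩, heK⟩
      · exact hpc.tail ⟨⟨e, rfl, hc.trans htail.symm⟩, heK⟩
  rcases key t hpath with hs | ⟨e, he, hp⟩
  · exact G.source_notMem_sinks (hs ▸ ht)
  · exact h e he hp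

/-- The separation condition of Menger's theorem for a set `S` of message channels together with a
full-rank error pattern. -/
theorem card_le_of_separates {n : ℕ} {t : V} (ht : t ∈ G.sinks) {S : Finset (Fin n)} {ρ : Finset E}
    (hρ : G.rank F w t ρ = ρ.card) (hn : S.Nonempty → S.card + ρ.card ≤ G.minCut t)
    (K : Finset (Fin n ⊕ E))
    (h : ∀ a ∈ S.disjSum ρ, ∀ b ∈ {b : Fin n ⊕ E | ∃ e, b = Sum.inr e ∧ G.head e = t},
      a ∉ K → ¬ ReflTransGen (fun u v => (∃ e, v = Sum.inr e ∧ G.ExtAdj u e) ∧ v ∉ K) a b) :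
    (S.disjSum ρ).card ≤ K.card := by
  classical
  set KE := K.preimage Sum.inr Sum.inr_injective.injOn with hKE
  have himg : KE.image (Sum.inr : E → Fin n ⊕ E) ⊆ K := by
    intro x hx
    obtain ⟨e, he, rfl⟩ := Finset.mem_image.mp hx
    simpa [hKE] using he
  have hcard : KE.card ≤ K.card := by
    rw [← Finset.card_image_of_injective KE (Sum.inr_injective (α := Fin n))]
    exact Finset.card_le_card himg
  rw [Finset.card_disjSum]
  -- If `K` contains all message channels of `S`, its real channels dominate `ρ` and number at least
  -- `|ρ|`. Otherwise some message channel is cut off by the real channels of `K` alone, which then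
  -- form a cut.
  by_cases hall : ∀ i ∈ S, Sum.inl i ∈ K
  · have hdom : G.Dominated F w t ρ KE := dominated_of_separates fun d hd e he hdK hpath => by
      refine h (Sum.inr d) (by simpa using hd) (Sum.inr e) ⟨e, rfl, he⟩ (by simpa [hKE] using hdK) ?_
      refine hpath.lift Sum.inr fun u v huv => ⟨⟨v, rfl, huv.1⟩, by simpa [hKE] using huv.2⟩
    have h1 := hdom.rank_le
    have h2 : S.disjSum KE ⊆ K := by
      intro x hx
      rcases x with i | e
      · exact hall i (by simpa using hx)
      · exact himg (by simpa using hx)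
    have h3 := Finset.card_le_card h2
    rw [Finset.card_disjSum] at h3
    omega
  · push Not at hall
    obtain ⟨i, hiS, hi⟩ := hall
    have : G.minCut t ≤ KE.card := minCut_le_card (isCut_of_separates ht i fun e he hp =>
      h (Sum.inl i) (by simpa using hiS) (Sum.inr e) ⟨e, rfl, he⟩ hi hp)
    have := hn ⟨i, hiS⟩
    omega

theorem minCut_le_card_In {t : V} [Fintype (G.In t)] (ht : t ∈ G.sinks) :
    G.minCut t ≤ Fintype.card (G.In t) := by
  classical
  rw [Fintype.card_subtype]
  refine minCut_le_card fun hpath => ?_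
  rcases hpath.cases_tail with h | ⟨c, _, e, he, _, het⟩
  · exact G.source_notMem_sinks (h ▸ ht)
  · simp [het] at he

end Rank

end Network

/-! ### Linear algebra and the greedy construction -/

/-- A vector space over a finite field with `q` elements is not a union of `q` proper subspaces. -/
theorem exists_notMem_of_card_le {F W I : Type*} [Field F] [Fintype F] [AddCommGroup W]
    [Module F W] [Finite W] [Fintype I] (hI : Fintype.card I ≤ Fintype.card F)
    (U : I → Submodule F W) : ∃ k, ∀ x, U x ≠ ⊤ → k ∉ U x := by
  classical
  have := Fintype.ofFinite W
  by_contra! hcover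
  have hcard : ∀ x, U x ≠ ⊤ → Fintype.card F * (Finset.univ.filter (· ∈ U x)).card
      ≤ Fintype.card W := by
    intro x hx
    have h1 : Module.finrank F (U x) < Module.finrank F W :=
      Submodule.finrank_lt hx
    rw [← Fintype.card_subtype, Module.card_eq_pow_finrank (K := F) (V := W)]
    have h2 : Fintype.card {y // y ∈ U x} = Fintype.card F ^ Module.finrank F (U x) :=
      Module.card_eq_pow_finrank
    rw [h2, ← pow_succ']
    exact Nat.pow_le_pow_right Fintype.card_pos h1
  set J := Finset.univ.filter fun x => U x ≠ ⊤ with hJ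
  -- All subspaces share the zero vector. Counting only nonzero vectors yields the strict inequality
  -- even for exactly `q` subspaces.
  have hsub : (Finset.univ : Finset W).erase 0 ⊆
      J.biUnion fun x => (Finset.univ.filter (· ∈ U x)).erase 0 := by
    intro k hk
    obtain ⟨x, hx, hkx⟩ := hcover k
    simp only [Finset.mem_biUnion, Finset.mem_erase, Finset.mem_filter, Finset.mem_univ, true_and,
      hJ]
    exact ⟨x, hx, Finset.ne_of_mem_erase hk, hkx⟩
  have h1 := (Finset.card_le_card hsub).trans Finset.card_biUnion_le
  have h2 : ∀ x ∈ J, Fintype.card F * ((Finset.univ.filter (· ∈ U x)).erase 0).card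
      ≤ Fintype.card W - Fintype.card F := by
    intro x hx
    rw [Finset.card_erase_of_mem (by simp), Nat.mul_sub, mul_one]
    exact Nat.sub_le_sub_right (hcard x (by simpa [hJ] using hx)) _
  have hne : J.Nonempty := by
    obtain ⟨x, hx, _⟩ := hcover 0
    exact ⟨x, by simpa [hJ] using hx⟩
  rw [Finset.card_erase_of_mem (Finset.mem_univ _), Finset.card_univ] at h1
  have h3 : Fintype.card F * (Fintype.card W - 1)
      ≤ Fintype.card F * (Fintype.card W - Fintype.card F) := by
    calc _ ≤ Fintype.card F * ∑ x ∈ J, ((Finset.univ.filter (· ∈ U x)).erase 0).card :=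
          Nat.mul_le_mul_left _ h1
      _ = ∑ x ∈ J, Fintype.card F * ((Finset.univ.filter (· ∈ U x)).erase 0).card :=
          Finset.mul_sum _ _ _
      _ ≤ ∑ _x ∈ J, (Fintype.card W - Fintype.card F) := Finset.sum_le_sum h2
      _ = J.card * (Fintype.card W - Fintype.card F) := by simp
      _ ≤ _ := Nat.mul_le_mul_right _ (by
          have : J.card ≤ Fintype.card I := Finset.card_le_univ J
          omega)
  have h4 := Nat.le_of_mul_le_mul_left h3 Fintype.card_pos
  have h5 : 1 < Fintype.card F := Fintype.one_lt_card
  obtain ⟨x, hx⟩ := hne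
  have h6 := hcard x (by simpa [hJ] using hx)
  have h7 : 0 < (Finset.univ.filter (· ∈ U x)).card :=
    Finset.card_pos.mpr ⟨0, by simp⟩
  have h8 := Nat.le_mul_of_pos_right (Fintype.card F) h7
  omega

/-- An independent family stays independent when one vector is replaced by a vector outside the
span of the others. -/
theorem LinearIndependent.of_replace {F W ι : Type*} [Field F] [AddCommGroup W] [Module F W]
    {v v' : ι → W} (hv : LinearIndependent F v) (a₀ : ι) (h : ∀ a, a ≠ a₀ → v' a = v a)
    (h₀ : v' a₀ ∉ Submodule.span F (v '' {a₀}ᶜ)) : LinearIndependent F v' := by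
  classical
  have hset : v' '' {a₀}ᶜ = v '' {a₀}ᶜ := Set.image_congr fun a ha => h a ha
  rw [linearIndependent_iff'] at hv ⊢
  intro s g hg
  have hg0 : ∀ i ∈ s, i = a₀ → g i = 0 := by
    rintro i hi rfl
    by_contra hne
    apply h₀
    rw [← Finset.add_sum_erase s _ hi] at hg
    have : v' i = -(g i)⁻¹ • ∑ x ∈ s.erase i, g x • v' x := by
      rw [eq_neg_of_add_eq_zero_right hg]
      simp [smul_smul, hne]
    rw [this, ← hset]
    refine Submodule.smul_mem _ _ (Submodule.sum_mem _ fun x hx => Submodule.smul_mem _ _ ?_)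
    exact Submodule.subset_span ⟨x, by simpa using Finset.ne_of_mem_erase hx, rfl⟩
  refine hv s g ?_
  rw [← hg]
  refine Finset.sum_congr rfl fun i hi => ?_
  by_cases hia : i = a₀
  · rw [hg0 i hi hia, zero_smul, zero_smul]
  · rw [h i hia]

namespace Network

variable {V E : Type*} {G : Network V E}

/-- A topological levelling of all channels, injective apart from the channels into sinks. -/
theorem exists_channel_levels [Fintype E] (n : ℕ) : ∃ (lvl : Fin n ⊕ E → ℕ) (L : ℕ),
    (∀ m e, G.ExtAdj m e → lvl m < lvl (Sum.inr e)) ∧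
    (∀ e, G.head e ∈ G.sinks → lvl (Sum.inr e) = L) ∧ (∀ m, lvl m ≤ L) ∧
    ∀ m m', lvl m = lvl m' → lvl m < L → m = m' := by
  classical
  obtain ⟨τ, hinj, hlt, hmono⟩ := exists_topological_numbering G.Adj transGen_adj_irrefl
  refine ⟨Sum.elim (fun i => i)
    fun e => if G.head e ∈ G.sinks then n + Fintype.card E else n + τ e,
    n + Fintype.card E, ?_, ?_, ?_, ?_⟩
  · rintro (i | d) e h
    · simp only [Sum.elim_inl, Sum.elim_inr]
      split_ifs <;> omega
    · have h : G.Adj d e := h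
      have hd : G.head d ∉ G.sinks := by
        rw [show G.head d = G.tail e from h]; exact G.tail_notMem_sinks e
      have h1 := hmono d e h
      have h2 := hlt d
      simp only [Sum.elim_inr, if_neg hd]
      split_ifs <;> omega
  · intro e he
    simp [he]
  · rintro (i | d)
    · simp only [Sum.elim_inl]; omega
    · have h2 := hlt d
      simp only [Sum.elim_inr]
      split_ifs <;> omega
  · rintro (i | d) (i' | d')
    · simp only [Sum.elim_inl]
      exact fun h _ => by rw [Fin.ext h]
    · simp only [Sum.elim_inl, Sum.elim_inr]
      split_ifs <;> omega
    · simp only [Sum.elim_inl, Sum.elim_inr]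
      split_ifs <;> omega
    · have h2 := hlt d
      have h3 := hlt d'
      simp only [Sum.elim_inr]
      intro h h'
      have : τ d = τ d' := by split_ifs at h h' <;> omega
      rw [hinj this]

variable [Fintype E] {F : Type*} [Field F] {w : ℕ}

theorem Code.linearIndependent_decodingMatrix_of_sink (C : G.Code F w) {t : V} (ht : t ∈ G.sinks)
    {ι : Type*} (p : ι → E) (hp : Function.Injective p) (hpt : ∀ a, G.head (p a) = t) :
    LinearIndependent F fun a => C.decodingMatrix t (Sum.inr (p a)) := by
  classical
  have h := (Pi.basisFun F (G.In t)).linearIndependent.comp (fun a => ⟨p a, hpt a⟩)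
    fun a b hab => hp (congrArg Subtype.val hab)
  convert h using 2 with a
  rw [Function.comp_apply, Pi.basisFun_apply,
    ← C.decodingMatrix_of_sink ht ⟨p a, hpt a⟩]

/-- Greedy code construction: over a field with at least `|I|` elements, finitely many conditions
that certain channels have independent rows in a decoding matrix can be met simultaneously,
provided that no small set separates these channels from the sink. -/
theorem exists_code_linearIndependent [Fintype F] {I : Type*} [Fintype I]
    (hI : Fintype.card I ≤ Fintype.card F) (t : I → V) (ht : ∀ x, t x ∈ G.sinks)
    (A : I → Finset (Fin w ⊕ E))
    (hsep : ∀ x, ∀ K : Finset (Fin w ⊕ E),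
      (∀ a ∈ A x, ∀ b ∈ {b : Fin w ⊕ E | ∃ e, b = Sum.inr e ∧ G.head e = t x}, a ∉ K →
        ¬ ReflTransGen (fun u v => (∃ e, v = Sum.inr e ∧ G.ExtAdj u e) ∧ v ∉ K) a b) →
      (A x).card ≤ K.card) :
    ∃ C : G.Code F w, ∀ x, LinearIndependent F fun a : A x => C.decodingMatrix (t x) a := by
  classical
  obtain ⟨lvl, L, hlt, hsink, hL, hinj⟩ := exists_channel_levels (G := G) w
  have hlink := fun x => exists_leveled_linking
    (fun u v : Fin w ⊕ E => ∃ e, v = Sum.inr e ∧ G.ExtAdj u e) (A x)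
    {b | ∃ e, b = Sum.inr e ∧ G.head e = t x} lvl L
    (by rintro u _ ⟨e, rfl, h⟩; exact hlt u e h)
    (by rintro _ ⟨e, rfl, h⟩; exact hsink e (h ▸ ht x)) hL (hsep x)
  choose p hp0 hpinj hpstep hplvl hpL using hlink
  -- Downward induction on the level: the rows at the `j`-th front of each linking are independent.
  -- At level `L` the fronts have entered the sinks, so any code serves.
  have main : ∀ k j, j + k = L → ∃ C : G.Code F w, ∀ x,
      LinearIndependent F fun a : A x => C.decodingMatrix (t x) (p x j a) := by
    intro k
    induction k with
    | zero =>
      rintro j rfl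
      refine ⟨Code.ofCoef 0, fun x => ?_⟩
      choose q hq hqt using hpL x
      have := (Code.ofCoef (G := G) (0 : Fin w ⊕ E → E → F)).linearIndependent_decodingMatrix_of_sink
        (ht x) q (fun a b h => hpinj x _ (by
          show p x (j + 0) a = p x (j + 0) b
          rw [hq, hq, h])) hqt
      convert this using 3 with a
      exact hq a
    | succ k ih =>
      intro j hj
      obtain ⟨C, hC⟩ := ih (j + 1) (by omega)
      by_cases hm : ∃ m, lvl m = j
      · obtain ⟨m, hm⟩ := hm
        have huniq : ∀ m', lvl m' = j → m' = m := fun m' h => hinj _ _ (h.trans hm.symm) (by omega)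
        have hstay : ∀ x a, p x j a ≠ m → p x (j + 1) a = p x j a := fun x a h =>
          (hpstep x j a).resolve_right fun h' => h (huniq _ h'.1)
        let T : ∀ x, (E → F) →ₗ[F] (G.In (t x) → F) := fun x =>
          { toFun := fun k => ∑ e, (if G.ExtAdj m e then k e else 0) •
              C.decodingMatrix (t x) (Sum.inr e)
            map_add' := fun k k' => by
              rw [← Finset.sum_add_distrib]
              refine Finset.sum_congr rfl fun e _ => ?_
              split_ifs <;> simp [add_smul]
            map_smul' := fun c k => by
              rw [Finset.smul_sum]
              refine Finset.sum_congr rfl fun e _ => ?_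
              split_ifs <;> simp [mul_smul] }
        let v : ∀ x, A x → (G.In (t x) → F) := fun x a => C.decodingMatrix (t x) (p x (j + 1) a)
        -- The choices of coefficients of `m` for which its new row falls into the span of the other
        -- rows at the front of linking `x`.
        let U : I → Submodule F (E → F) := fun x =>
          (Submodule.span F (v x '' {a | p x j a ≠ m})).comap (T x)
        obtain ⟨k, hk⟩ := exists_notMem_of_card_le hI U
        -- The unit vector at the successor of `m` on its path is a permitted choice: it reproduces
        -- the row of that successor, which is independent of the others.
        have hUtop : ∀ x a, p x j a = m → U x ≠ ⊤ := by
          intro x a ha htop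
          have hadj : ∃ e, p x (j + 1) a = Sum.inr e ∧ G.ExtAdj m e := by
            rcases hpstep x j a with h | ⟨_, h⟩
            · have := hplvl x (j + 1) a (by omega)
              rw [h, ha] at this
              omega
            · rwa [ha] at h
          obtain ⟨e, he, hme⟩ := hadj
          have hmem : Pi.single e 1 ∈ U x := htop ▸ Submodule.mem_top
          have hT : T x (Pi.single e 1) = v x a := by
            show ∑ c, (if G.ExtAdj m c then (Pi.single e 1 : E → F) c else 0) •
              C.decodingMatrix (t x) (Sum.inr c) = C.decodingMatrix (t x) (p x (j + 1) a)
            rw [Finset.sum_eq_single e]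
            · simp [hme, he]
            · intro c _ hc
              simp [hc]
            · simp
          have hmem : T x (Pi.single e 1) ∈ Submodule.span F (v x '' {a | p x j a ≠ m}) := hmem
          rw [hT] at hmem
          exact (hC x).notMem_span_image (s := {a | p x j a ≠ m}) (by simpa using ha) hmem
        let C' : G.Code F w := Code.ofCoef fun m' => if m' = m then k else C.coef m'
        have hcoef : ∀ m', m' ≠ m → C'.coef m' = C.coef m' := by
          intro m' h
          funext e
          rw [Code.coef_ofCoef, if_neg h]
          split_ifs with h'
          · rfl
          · exact (C.coef_eq_zero h').symm
        have hrow : ∀ x m', j + 1 ≤ lvl m' →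
            C'.decodingMatrix (t x) m' = C.decodingMatrix (t x) m' := fun x m' h =>
          Code.decodingMatrix_congr C' C lvl hlt (j + 1)
            (fun m' h => hcoef m' (by rintro rfl; omega)) _ m' h
        have hrowm : ∀ x, C'.decodingMatrix (t x) m = T x k := by
          intro x
          rw [C'.decodingMatrix_of_head_ne]
          · refine Finset.sum_congr rfl fun e _ => ?_
            rw [Code.coef_ofCoef, if_pos rfl]
            split_ifs with h
            · have := hlt _ _ h
              rw [hrow x _ (by omega)]
            · rw [zero_smul, zero_smul]
          · rintro e he rfl
            have := hsink e (he ▸ ht x)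
            omega
        refine ⟨C', fun x => ?_⟩
        by_cases hx : ∃ a, p x j a = m
        · obtain ⟨a₀, ha₀⟩ := hx
          have hset : {a | p x j a ≠ m} = {a₀}ᶜ := by
            ext a
            simp only [Set.mem_ofPred_eq, Set.mem_compl_iff, Set.mem_singleton_iff, not_iff_not]
            exact ⟨fun h => hpinj x j (h.trans ha₀.symm), fun h => h ▸ ha₀⟩
          refine (hC x).of_replace a₀ (fun a ha => ?_) ?_
          · have ha : p x j a ≠ m := fun h => ha (hpinj x j (h.trans ha₀.symm))
            rw [← hstay x a ha, hrow]
            exact hplvl x (j + 1) a (by omega)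
          · have := hk x (hUtop x a₀ ha₀)
            rw [ha₀, hrowm, ← hset]
            exact this
        · have hx : ∀ a, p x j a ≠ m := fun a h => hx ⟨a, h⟩
          convert hC x using 2 with a
          rw [← hstay x a (hx a), hrow]
          exact hplvl x (j + 1) a (by omega)
      · refine ⟨C, fun x => ?_⟩
        convert hC x using 3 with a
        exact ((hpstep x j a).resolve_right fun h => hm ⟨_, h.1⟩).symm
  obtain ⟨C, hC⟩ := main L 0 (by omega)
  exact ⟨C, fun x => by simpa only [hp0] using hC x⟩

end Network

/-! ### Reduction to full-rank patterns, and the first bound -/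

namespace Network

variable {V E : Type*} {G : Network V E} [Fintype E] {F : Type*} [Field F] {w : ℕ}

theorem Code.single_mem_errorSpace (C : G.Code F w) {t : V} (ht : t ∈ G.sinks) {ρ : Finset E}
    [DecidableEq (G.In t)] (e : G.In t) (he : (e : E) ∈ ρ) :
    Pi.single e 1 ∈ C.errorSpace t ρ := by
  classical
  rw [errorSpace_eq_span]
  refine Submodule.subset_span ⟨⟨e, he⟩, ?_⟩
  convert C.decodingMatrix_of_sink ht e

theorem Code.errorSpace_eq_top (C : G.Code F w) {t : V} (ht : t ∈ G.sinks) (ρ : Finset E)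
    (h : ∀ e : G.In t, C.decodingMatrix t (Sum.inr e) ∈ C.errorSpace t ρ) :
    C.errorSpace t ρ = ⊤ := by
  classical
  refine top_le_iff.mp ?_
  rw [← (Pi.basisFun F (G.In t)).span_eq, Submodule.span_le]
  rintro _ ⟨e, rfl⟩
  rw [Pi.basisFun_apply, ← C.decodingMatrix_of_sink ht e]
  exact h e

/-- A full-rank error pattern has independent rows in the decoding matrix of some code. -/
theorem exists_code_errorSpace [Fintype F] {t : V} (ht : t ∈ G.sinks) {ρ : Finset E}
    (hρ : G.rank F w t ρ = ρ.card) :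
    ∃ C : G.Code F w, Module.finrank F (C.errorSpace t ρ) = ρ.card := by
  obtain ⟨C, hC⟩ := exists_code_linearIndependent (G := G) (F := F) (w := w) (I := Unit)
    (Fintype.card_unit.trans_le (Nat.succ_le_of_lt Fintype.card_pos)) (fun _ => t) (fun _ => ht)
    (fun _ => (∅ : Finset (Fin w)).disjSum ρ)
    (fun _ => card_le_of_separates ht hρ (by simp))
  refine ⟨C, ?_⟩
  have h : LinearIndependent F fun e : ρ => C.decodingMatrix t (Sum.inr e) :=
    (hC ()).comp (fun e : ρ => ⟨Sum.inr e, Finset.inr_mem_disjSum.mpr e.2⟩)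
      fun a b hab => Subtype.ext (Sum.inr_injective (congrArg Subtype.val hab))
  rw [Code.errorSpace_eq_span, finrank_span_eq_card h, Fintype.card_coe]

/-- In a code where `Δ(t, ρ)` has dimension `|ρ| < C_t ≤ |In(t)|`, some channel into `t` has its row
outside this space. Adding the channel raises the dimension, and hence the rank. -/
theorem exists_insert_fullRank [Fintype F] {t : V} (ht : t ∈ G.sinks) {ρ : Finset E}
    (hρ : G.rank F w t ρ = ρ.card) (hlt : ρ.card < G.minCut t) :
    ∃ ρ', ρ ⊆ ρ' ∧ ρ'.card = ρ.card + 1 ∧ G.rank F w t ρ' = ρ'.card := by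
  classical
  obtain ⟨C, hC⟩ := exists_code_errorSpace ht hρ
  obtain ⟨e, he⟩ : ∃ e : G.In t, C.decodingMatrix t (Sum.inr e) ∉ C.errorSpace t ρ := by
    by_contra! h
    have h1 := C.errorSpace_eq_top ht ρ h
    have h2 := minCut_le_card_In (G := G) ht
    rw [h1, finrank_top, Module.finrank_fintype_fun_eq_card] at hC
    omega
  have hsub : C.errorSpace t ρ ≤ C.errorSpace t (insert e.1 ρ) := by
    rw [Code.errorSpace_eq_span, Code.errorSpace_eq_span]
    refine Submodule.span_mono ?_
    rintro _ ⟨c, rfl⟩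
    exact ⟨⟨c, Finset.mem_insert_of_mem c.2⟩, rfl⟩
  have hmem : C.decodingMatrix t (Sum.inr e) ∈ C.errorSpace t (insert e.1 ρ) := by
    rw [Code.errorSpace_eq_span]
    exact Submodule.subset_span ⟨⟨e, Finset.mem_insert_self _ _⟩, rfl⟩
  have hss : C.errorSpace t ρ < C.errorSpace t (insert e.1 ρ) :=
    lt_of_le_of_ne hsub fun h => he (h ▸ hmem)
  have h1 := Submodule.finrank_lt_finrank_of_lt hss
  have h2 := finrank_errorSpace_le_rank C t (insert e.1 ρ)
  have h3 := (Dominated.refl (G := G) (F := F) (w := w) t (insert e.1 ρ)).rank_le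
  have h4 := Finset.card_insert_le e.1 ρ
  exact ⟨insert e.1 ρ, Finset.subset_insert _ _, by omega, by omega⟩

/-- Full-rank error patterns extend to full-rank patterns of any size up to the minimum cut. -/
theorem exists_superset_fullRank [Fintype F] {t : V} (ht : t ∈ G.sinks) {β : ℕ}
    (hβ : β ≤ G.minCut t) {ρ : Finset E} (hρ : G.rank F w t ρ = ρ.card) (hle : ρ.card ≤ β) :
    ∃ ρ' ∈ G.fullRankPatterns F w t β, ρ ⊆ ρ' := by
  obtain ⟨k, hk⟩ := Nat.exists_eq_add_of_le hle
  induction k generalizing ρ with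
  | zero => exact ⟨ρ, ⟨by omega, by omega⟩, subset_rfl⟩
  | succ k ih =>
    obtain ⟨ρ', hsub, hcard, hrank⟩ := exists_insert_fullRank ht hρ (by omega)
    obtain ⟨ρ'', hmem, hsub'⟩ := ih hrank (by omega) (by omega)
    exact ⟨ρ'', hmem, hsub.trans hsub'⟩

theorem rank_empty (t : V) : G.rank F w t ∅ = 0 := by
  simpa using (Dominated.refl (G := G) (F := F) (w := w) t ∅).rank_le

/-- A smallest dominating pattern has full rank, since domination is transitive; it is then enlarged
to size `β`. -/
theorem exists_fullRank_errorSpace_le [Fintype F] {t : V} (ht : t ∈ G.sinks) {β : ℕ}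
    (hβ : β ≤ G.minCut t) {ρ : Finset E} (hρ : G.rank F w t ρ ≤ β) :
    ∃ ρ' ∈ G.fullRankPatterns F w t β, G.Dominated F w t ρ ρ' := by
  obtain ⟨ρ', hdom, hcard⟩ := exists_dominated_card_eq_rank (G := G) (F := F) (w := w) t ρ
  have hrank : G.rank F w t ρ' = ρ'.card := by
    refine le_antisymm (Dominated.refl t ρ').rank_le ?_
    obtain ⟨ρ'', hdom', hcard'⟩ := exists_dominated_card_eq_rank (G := G) (F := F) (w := w) t ρ'
    have : G.Dominated F w t ρ ρ'' := fun C => (hdom C).trans (hdom' C)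
    rw [hcard, ← hcard']
    exact this.rank_le
  obtain ⟨σ, hσ, hsub⟩ := exists_superset_fullRank ht hβ hrank (by omega)
  refine ⟨σ, hσ, fun C => (hdom C).trans ?_⟩
  rw [Code.errorSpace_eq_span, Code.errorSpace_eq_span]
  refine Submodule.span_mono ?_
  rintro _ ⟨c, rfl⟩
  exact ⟨⟨c, hsub c.2⟩, rfl⟩

/-- A code corrects the error pattern `ρ` at `t` if no nonzero message is mapped into the error
space of `ρ`. -/
def Code.Separates (C : G.Code F w) (t : V) (ρ : Finset E) : Prop :=
  ∀ X : Fin w → F, ∑ i, X i • C.decodingMatrix t (Sum.inl i) ∈ C.errorSpace t ρ → X = 0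

/-- It suffices to separate the full-rank error patterns of one size from the messages. -/
theorem Code.isRegular_and_degradation_le [Fintype F] (C : G.Code F w) {d : ℕ} (hw : 1 ≤ w)
    (hd : ∀ t ∈ G.sinks, d ≤ G.redundancy w t)
    (hC : ∀ t ∈ G.sinks, ∀ ρ ∈ G.fullRankPatterns F w t (G.redundancy w t - d),
      C.Separates t ρ) :
    C.IsRegular ∧ ∀ t ∈ G.sinks, C.degradation t ≤ d := by
  classical
  have hβ : ∀ t, G.redundancy w t - d ≤ G.minCut t := fun t => by
    unfold redundancy; omega
  have hreg : C.IsRegular := by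
    intro t ht
    -- The hypothesis `hC` says something only because full-rank patterns of the required size exist
    -- at every sink.
    obtain ⟨ρ, hρ, _⟩ := exists_superset_fullRank (F := F) (w := w) ht (hβ t) (ρ := ∅)
      (by simpa using rank_empty t) (by simp)
    have hind : LinearIndependent F fun i => C.decodingMatrix t (Sum.inl i) := by
      rw [Fintype.linearIndependent_iff]
      intro X hX
      have := hC t ht ρ hρ X (by rw [hX]; exact Submodule.zero_mem _)
      exact fun i => congrFun this i
    have hspan : C.messageSpace t
        = Submodule.span F (Set.range fun i => C.decodingMatrix t (Sum.inl i)) := by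
      ext y
      rw [C.mem_messageSpace, Submodule.mem_span_range_iff_exists_fun]
    rw [hspan, finrank_span_eq_card hind, Fintype.card_fin]
  refine ⟨hreg, fun t ht => ?_⟩
  have hmin : G.redundancy w t - d + 1 ≤ C.minDist t := by
    -- Over an empty set the infimum would be 0. The pattern of all channels is a member, its error
    -- space being the whole space.
    have hne : {n | ∃ ρ : Finset E, 0 < Module.finrank F ↥(C.errorSpace t ρ ⊓ C.messageSpace t) ∧
        G.rank F w t ρ = n}.Nonempty := by
      refine ⟨_, Finset.univ, ?_, rfl⟩
      rw [C.errorSpace_eq_top ht, top_inf_eq, hreg t ht]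
      · omega
      · intro e
        rw [C.decodingMatrix_of_sink ht]
        exact C.single_mem_errorSpace ht e (Finset.mem_univ _)
    obtain ⟨ρ, hpos, hrank⟩ := Nat.sInf_mem hne
    change G.rank F w t ρ = C.minDist t at hrank
    rw [← hrank]
    by_contra hlt
    obtain ⟨ρ', hρ', hdom⟩ := exists_fullRank_errorSpace_le ht (hβ t)
      (show G.rank F w t ρ ≤ G.redundancy w t - d by omega)
    have hbot : C.errorSpace t ρ ⊓ C.messageSpace t = ⊥ := by
      rw [eq_bot_iff]
      rintro y ⟨hy1, hy2⟩
      obtain ⟨X, rfl⟩ := (C.mem_messageSpace t y).mp hy2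
      rw [hC t ht ρ' hρ' X (hdom C hy1)]
      simp
    rw [hbot, finrank_bot] at hpos
    exact hpos.false
  have := hd t ht
  unfold degradation
  omega

/-- The first field size bound. -/
theorem exists_code_of_sum_fullRankPatterns_le [Fintype F] {d : ℕ}
    (hwC : ∀ t ∈ G.sinks, w ≤ G.minCut t)
    (h : ∑ t ∈ G.sinks, (G.fullRankPatterns F w t (G.redundancy w t - d)).ncard
      ≤ Fintype.card F) :
    ∃ C : G.Code F w, ∀ t ∈ G.sinks, ∀ ρ ∈ G.fullRankPatterns F w t (G.redundancy w t - d),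
      C.Separates t ρ := by
  classical
  let I := Σ t : G.sinks, G.fullRankPatterns F w (t : V) (G.redundancy w t - d)
  have hI : Fintype.card I ≤ Fintype.card F := by
    rw [Fintype.card_sigma]
    refine le_trans (le_of_eq ?_) h
    rw [← Finset.sum_coe_sort G.sinks]
    exact Finset.sum_congr rfl fun t _ => by rw [Set.ncard_eq_toFinset_card', Set.toFinset_card]
  obtain ⟨C, hC⟩ := exists_code_linearIndependent (G := G) (w := w) hI (fun x => x.1)
    (fun x => x.1.2) (fun x => (Finset.univ : Finset (Fin w)).disjSum x.2.1)
    (fun x => card_le_of_separates (F := F) (w := w) x.1.2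
      (x.2.2.2.trans x.2.2.1.symm) (fun _ => by
        have h1 := hwC x.1 x.1.2
        have h2 := x.2.2.1
        rw [Finset.card_univ, Fintype.card_fin, h2]
        unfold redundancy
        omega))
  refine ⟨C, fun t ht ρ hρ X hX => ?_⟩
  have hind := hC ⟨⟨t, ht⟩, ⟨ρ, hρ⟩⟩
  rw [Fintype.linearIndependent_iff] at hind
  obtain ⟨Z, hZ⟩ := (C.mem_errorSpace t ρ _).mp hX
  have h0 := hind (fun a => Sum.elim X (fun e => -Z e) a.1) (by
    rw [Finset.sum_coe_sort ((Finset.univ : Finset (Fin w)).disjSum ρ)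
      (fun a => Sum.elim X (fun e => -Z e) a • C.decodingMatrix t a), Finset.sum_disjSum]
    simp only [Sum.elim_inl, Sum.elim_inr, neg_smul, Finset.sum_neg_distrib]
    rw [hZ, add_neg_cancel])
  funext i
  exact h0 ⟨Sum.inl i, by simp⟩

end Network

/-! ### Counting random combinations, and the potential -/

section Counting

variable {F W : Type*} [Field F] [AddCommGroup W] [Module F W]

theorem Submodule.finrank_map_mkQ_add_finrank [FiniteDimensional F W] {U S : Submodule F W}
    (h : U ≤ S) : Module.finrank F (S.map U.mkQ) + Module.finrank F U = Module.finrank F S := by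
  have h1 := LinearMap.finrank_range_add_finrank_ker (U.mkQ.domRestrict S)
  rw [LinearMap.range_domRestrict, LinearMap.ker_domRestrict, Submodule.ker_mkQ] at h1
  rw [← h1, ← (Submodule.submoduleOfEquivOfLe h).finrank_eq]
  rfl

/-- From a family of vectors one can select members satisfying `mv` that form a basis modulo the
span of the members not satisfying `mv`. -/
theorem exists_basis_modulo.{u} {A : Type u} [Finite A] [FiniteDimensional F W] (f : A → W)
    (mv : A → Prop) :
    ∃ (κ : Type u) (_ : Fintype κ) (s : κ → A), Function.Injective s ∧ (∀ i, mv (s i)) ∧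
      (∀ c : κ → F, ∑ i, c i • f (s i) ∈ Submodule.span F (f '' {a | ¬ mv a}) → c = 0) ∧
      Fintype.card κ + Module.finrank F (Submodule.span F (f '' {a | ¬ mv a}))
        = Module.finrank F (Submodule.span F (Set.range f)) := by
  set U := Submodule.span F (f '' {a | ¬ mv a}) with hU
  obtain ⟨κ, s, hs, hspan, hind⟩ :=
    exists_linearIndependent' F (fun a : {a // mv a} => U.mkQ (f a))
  have : Finite κ := Finite.of_injective s hs
  have := Fintype.ofFinite κ
  refine ⟨κ, this, fun i => s i, fun i j h => hs (Subtype.ext h), fun i => (s i).2, ?_, ?_⟩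
  · intro c hc
    rw [Fintype.linearIndependent_iff] at hind
    funext i
    refine hind c ?_ i
    rw [← Submodule.ker_mkQ U, LinearMap.mem_ker, map_sum] at hc
    simpa using hc
  · have hle : U ≤ Submodule.span F (Set.range f) :=
      Submodule.span_mono (Set.image_subset_range _ _)
    rw [← Submodule.finrank_map_mkQ_add_finrank hle]
    congr 1
    rw [← finrank_span_eq_card hind, hspan]
    suffices h : (Submodule.span F (Set.range f)).map U.mkQ
        = Submodule.span F (Set.range fun a : {a // mv a} => U.mkQ (f a)) by rw [h]
    rw [Submodule.map_span]
    refine le_antisymm (Submodule.span_le.mpr ?_) (Submodule.span_mono ?_)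
    · rintro _ ⟨_, ⟨a, rfl⟩, rfl⟩
      by_cases ha : mv a
      · exact Submodule.subset_span ⟨⟨a, ha⟩, rfl⟩
      · have : U.mkQ (f a) = 0 := by
          rw [← LinearMap.mem_ker, Submodule.ker_mkQ]
          exact Submodule.subset_span ⟨a, ha, rfl⟩
        rw [this]
        exact Submodule.zero_mem _
    · rintro _ ⟨a, rfl⟩
      exact ⟨f a, ⟨a, rfl⟩, rfl⟩

variable [Fintype F] {D O ι σ : Type*} [Fintype D] [DecidableEq D] [Fintype O] [DecidableEq O]
  [Fintype ι] [Fintype σ]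

open Classical in
/-- A fixed nontrivial combination of random combinations of the vectors `v e` lies in `U` with
probability at most `q⁻ʳ`, if `r` of these vectors are independent modulo `U`. -/
theorem card_combination_mem_mul_le (v : O → W) (U : Submodule F W) (pos : ι → D)
    (hpos : Function.Injective pos) (s : σ → O)
    (hs : ∀ c : σ → F, ∑ i, c i • v (s i) ∈ U → c = 0) (z : ι → F) (hz : z ≠ 0) :
    (Finset.univ.filter fun k : D → O → F =>
        ∑ i, z i • Fintype.linearCombination F v (k (pos i)) ∈ U).card
      * Fintype.card F ^ Fintype.card σ ≤ Fintype.card (D → O → F) := by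
  obtain ⟨i₀, hi₀⟩ := Function.ne_iff.mp hz
  let Φ : (D → O → F) →ₗ[F] W :=
    ∑ i, z i • (Fintype.linearCombination F v) ∘ₗ LinearMap.proj (pos i)
  have hΦ : ∀ k, Φ k = ∑ i, z i • Fintype.linearCombination F v (k (pos i)) := fun k => by
    simp [Φ]
  let ext : (σ → F) → O → F := fun c => ∑ i, c i • Pi.single (s i) 1
  have hext : ∀ c, Fintype.linearCombination F v (ext c) = ∑ i, c i • v (s i) := fun c => by
    simp only [ext, map_sum, map_smul]
    simp
  have hΦs : ∀ c, Φ (Pi.single (pos i₀) (ext c)) = z i₀ • ∑ i, c i • v (s i) := fun c => by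
    rw [hΦ, Finset.sum_eq_single i₀, Pi.single_eq_same, hext]
    · intro i _ hi
      rw [Pi.single_eq_of_ne (hpos.ne hi), map_zero, smul_zero]
    · simp
  have hcard : Fintype.card F ^ Fintype.card σ = (Finset.univ : Finset (σ → F)).card := by
    rw [Finset.card_univ, Fintype.card_fun]
  rw [hcard, ← Finset.card_product, ← Finset.card_univ]
  -- Shifting the coefficients at position `i₀` by `ext c` changes the combination by `z i₀ • ∑ i, c
  -- i • v (s i)`. Modulo `U` these values differ for different `c`, so the translates of the bad
  -- set are disjoint.
  refine Finset.card_le_card_of_injOn (fun x => x.1 + Pi.single (pos i₀) (ext x.2))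
    (fun _ _ => Finset.mem_coe.mpr (Finset.mem_univ _)) ?_
  rintro ⟨k, c⟩ hk ⟨k', c'⟩ hk' heq
  simp only [Finset.coe_product, Set.mem_prod, Finset.mem_coe, Finset.mem_filter, Finset.mem_univ,
    true_and, and_true, ← hΦ] at hk hk'
  simp only at heq
  have h1 : Φ (Pi.single (pos i₀) (ext c)) - Φ (Pi.single (pos i₀) (ext c')) = Φ k' - Φ k := by
    rw [← map_sub, ← map_sub]
    congr 1
    rw [sub_eq_sub_iff_add_eq_add, add_comm, heq, add_comm]
  have h2 : z i₀ • (∑ i, (c - c') i • v (s i)) ∈ U := by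
    have : z i₀ • (∑ i, (c - c') i • v (s i)) = Φ k' - Φ k := by
      rw [← h1, hΦs, hΦs, ← smul_sub, ← Finset.sum_sub_distrib]
      simp [sub_smul]
    rw [this]
    exact U.sub_mem hk' hk
  have h3 := sub_eq_zero.mp (hs _ ((U.smul_mem_iff hi₀).mp h2))
  subst h3
  rw [Prod.mk.injEq]
  exact ⟨add_right_cancel heq, rfl⟩

open Classical in
/-- A first moment bound for the number of relations, modulo `U`, between random combinations. -/
theorem card_relations_mul_le (v : O → W) (U : Submodule F W) (pos : ι → D)
    (hpos : Function.Injective pos) (s : σ → O)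
    (hs : ∀ c : σ → F, ∑ i, c i • v (s i) ∈ U → c = 0) (x : ℕ) (bad : Finset (D → O → F))
    (hbad : ∀ k ∈ bad, x ≤ Module.finrank F (U.comap
      (Fintype.linearCombination F fun i => Fintype.linearCombination F v (k (pos i))))) :
    bad.card * ((Fintype.card F ^ x - 1) * Fintype.card F ^ Fintype.card σ)
      ≤ (Fintype.card F ^ Fintype.card ι - 1) * Fintype.card (D → O → F) := by
  let rel : (D → O → F) → (ι → F) → Prop := fun k z =>
    ∑ i, z i • Fintype.linearCombination F v (k (pos i)) ∈ U
  -- Pairs of a bad draw and a nonzero relation are counted in two ways; the zero relation always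
  -- holds and is left out.
  have h1 : ∀ k ∈ bad, Fintype.card F ^ x - 1
      ≤ (((Finset.univ : Finset (ι → F)).erase 0).filter (rel k)).card := by
    intro k hk
    set N := U.comap
      (Fintype.linearCombination F fun i => Fintype.linearCombination F v (k (pos i))) with hN
    have h2 : (Finset.univ.filter (· ∈ N)).card = Fintype.card F ^ Module.finrank F N := by
      rw [← Fintype.card_subtype]
      exact Module.card_eq_pow_finrank (K := F) (V := N)
    have h3 : ((Finset.univ : Finset (ι → F)).erase 0).filter (rel k)
        = (Finset.univ.filter (· ∈ N)).erase 0 := by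
      ext z
      rw [Finset.mem_filter, Finset.mem_erase, Finset.mem_erase, Finset.mem_filter]
      simp only [Finset.mem_univ, and_true, true_and]
      exact Iff.rfl
    rw [h3, Finset.card_erase_of_mem (by simp), h2]
    exact Nat.sub_le_sub_right (Nat.pow_le_pow_right Fintype.card_pos (hbad k hk)) 1
  have h2 : ∑ k ∈ bad, (((Finset.univ : Finset (ι → F)).erase 0).filter (rel k)).card
      = ∑ z ∈ (Finset.univ : Finset (ι → F)).erase 0, (bad.filter fun k => rel k z).card :=
    Finset.sum_card_bipartiteAbove_eq_sum_card_bipartiteBelow rel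
  calc bad.card * ((Fintype.card F ^ x - 1) * Fintype.card F ^ Fintype.card σ)
      = (∑ _k ∈ bad, (Fintype.card F ^ x - 1)) * Fintype.card F ^ Fintype.card σ := by
        rw [Finset.sum_const, smul_eq_mul, mul_assoc]
    _ ≤ (∑ k ∈ bad, (((Finset.univ : Finset (ι → F)).erase 0).filter (rel k)).card)
          * Fintype.card F ^ Fintype.card σ := Nat.mul_le_mul_right _ (Finset.sum_le_sum h1)
    _ = ∑ z ∈ (Finset.univ : Finset (ι → F)).erase 0,
          (bad.filter fun k => rel k z).card * Fintype.card F ^ Fintype.card σ := by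
        rw [h2, Finset.sum_mul]
    _ ≤ ∑ z ∈ (Finset.univ : Finset (ι → F)).erase 0, Fintype.card (D → O → F) := by
        refine Finset.sum_le_sum fun z hz => le_trans (Nat.mul_le_mul_right _ ?_)
          (card_combination_mem_mul_le v U pos hpos s hs z (Finset.ne_of_mem_erase hz))
        exact Finset.card_le_card (Finset.filter_subset_filter _ (Finset.subset_univ _))
    _ = _ := by
        rw [Finset.sum_const, smul_eq_mul, Finset.card_erase_of_mem (Finset.mem_univ _),
          Finset.card_univ, Fintype.card_fun]

/-- This trades the exact count `q ^ x - 1` for a pure power, so that bounds at successive nodes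
multiply. -/
theorem sub_one_pow_le_pow_sub_one {q x : ℕ} (hq : 1 ≤ q) (hx : x ≠ 0) :
    (q - 1) ^ x ≤ q ^ x - 1 := by
  have h := pow_add_pow_le (Nat.zero_le (q - 1)) (Nat.zero_le 1) hx
  rw [Nat.sub_add_cancel hq, one_pow] at h
  omega

open Classical in
/-- Replacing some members `v (e a)` of a family by random combinations of the vectors `v`
decreases the rank of the family by `x` with probability at most `(q - 1)⁻ˣ`. -/
theorem card_rank_drop_mul_le {A : Type*} [Finite A] [FiniteDimensional F W] (v : O → W)
    (mv : A → Prop) (f : A → W) (e : A → O) (hf : ∀ a, mv a → f a = v (e a)) (pos : A → D)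
    (hpos : ∀ a b, mv a → mv b → pos a = pos b → a = b) (g : (D → O → F) → A → W)
    (hg : ∀ k a, g k a = if mv a then Fintype.linearCombination F v (k (pos a)) else f a)
    (x : ℕ) :
    (Finset.univ.filter fun k : D → O → F => Module.finrank F (Submodule.span F (Set.range (g k)))
        + x ≤ Module.finrank F (Submodule.span F (Set.range f))).card * (Fintype.card F - 1) ^ x
      ≤ Fintype.card (D → O → F) := by
  set bad := Finset.univ.filter fun k : D → O → F =>
    Module.finrank F (Submodule.span F (Set.range (g k)))
        + x ≤ Module.finrank F (Submodule.span F (Set.range f)) with hbad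
  rcases eq_or_ne x 0 with rfl | hx
  · rw [pow_zero, mul_one]
    exact Finset.card_le_univ _
  obtain ⟨κ, _, s, hs, hmv, hind, hcard⟩ := exists_basis_modulo (F := F) f mv
  set U := Submodule.span F (f '' {a | ¬ mv a}) with hU
  -- There are as many redrawn vectors as independent directions modulo `U`, so the two powers of
  -- `q` cancel up to a factor below 1. A rank drop of `x` forces an `x`-dimensional space of
  -- relations among them.
  have key := card_relations_mul_le v U (pos ∘ s)
    (fun i j h => hs (hpos _ _ (hmv i) (hmv j) h)) (e ∘ s) (fun c hc => hind c (by
      convert hc using 3 with i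
      exact hf _ (hmv i))) x bad (by
    intro k hk
    have hk : Module.finrank F (Submodule.span F (Set.range (g k)))
        + x ≤ Module.finrank F (Submodule.span F (Set.range f)) := by simpa [hbad] using hk
    set S := Submodule.span F (Set.range (g k)) with hS
    have hUS : U ≤ S := by
      rw [hU, Submodule.span_le]
      rintro _ ⟨a, ha, rfl⟩
      refine Submodule.subset_span ⟨a, ?_⟩
      rw [hg, if_neg ha]
    have h1 := Submodule.finrank_map_mkQ_add_finrank hUS
    set T := Fintype.linearCombination F fun i =>
      Fintype.linearCombination F v (k ((pos ∘ s) i)) with hT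
    have h2 := LinearMap.finrank_range_add_finrank_ker (U.mkQ ∘ₗ T)
    rw [LinearMap.ker_comp, Submodule.ker_mkQ, Module.finrank_fintype_fun_eq_card] at h2
    have h3 : LinearMap.range (U.mkQ ∘ₗ T) ≤ S.map U.mkQ := by
      rw [LinearMap.range_comp]
      refine Submodule.map_mono ?_
      rw [hT, Fintype.range_linearCombination, Submodule.span_le]
      rintro _ ⟨i, rfl⟩
      refine Submodule.subset_span ⟨s i, ?_⟩
      rw [hg, if_pos (hmv i)]; rfl
    have h4 := Submodule.finrank_mono h3
    omega)
  have hpow : 0 < Fintype.card F ^ Fintype.card κ := pow_pos Fintype.card_pos _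
  have h1 : (bad.card * (Fintype.card F ^ x - 1)) * Fintype.card F ^ Fintype.card κ
      ≤ Fintype.card (D → O → F) * Fintype.card F ^ Fintype.card κ := by
    rw [mul_assoc]
    refine key.trans ?_
    rw [mul_comm]
    exact Nat.mul_le_mul_left _ (Nat.sub_le _ _)
  refine le_trans (Nat.mul_le_mul_left _ ?_) (Nat.le_of_mul_le_mul_right h1 hpow)
  exact sub_one_pow_le_pow_sub_one Fintype.card_pos hx

/-- Averaging the potential `(a + j).choose j / Qᵃ` over random rank drops. -/
theorem sum_potential_le {Ω : Type*} [Fintype Ω] (f : Ω → ℕ) (Q : ℝ) (hQ : 0 < Q)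
    (hf : ∀ x, ((Finset.univ.filter fun k => x ≤ f k).card : ℝ) * Q ^ x ≤ Fintype.card Ω)
    (j a : ℕ) :
    ∑ k, (((a - f k) + j).choose j : ℝ) / Q ^ (a - f k)
      ≤ Fintype.card Ω * (((a + (j + 1)).choose (j + 1) : ℝ) / Q ^ a) := by
  -- Draws are grouped by the drop truncated at `a`, matching the truncated difference `a - f k`.
  -- Each fibre is bounded by its tail probability, and the hockey-stick identity sums the
  -- binomials.
  rw [← Finset.sum_fiberwise_of_maps_to (s := Finset.univ) (t := Finset.range (a + 1))
    (g := fun k => min (f k) a) (fun k _ => by simp)]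
  have hterm : ∀ x ∈ Finset.range (a + 1),
      ∑ k ∈ Finset.univ.filter (fun k => min (f k) a = x),
        (((a - f k) + j).choose j : ℝ) / Q ^ (a - f k)
      ≤ Fintype.card Ω / Q ^ a * ((a - x) + j).choose j := by
    intro x hx
    have hxa : x ≤ a := by simpa [Nat.lt_succ_iff] using hx
    have h1 : ∀ k ∈ Finset.univ.filter (fun k => min (f k) a = x),
        (((a - f k) + j).choose j : ℝ) / Q ^ (a - f k)
          = (((a - x) + j).choose j : ℝ) / Q ^ (a - x) := by
      intro k hk
      have : min (f k) a = x := by simpa using hk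
      rw [show a - f k = a - x by omega]
    rw [Finset.sum_congr rfl h1, Finset.sum_const, nsmul_eq_mul]
    have h2 : ((Finset.univ.filter fun k => min (f k) a = x).card : ℝ)
        ≤ Fintype.card Ω / Q ^ x := by
      rw [le_div_iff₀ (pow_pos hQ _)]
      refine le_trans (mul_le_mul_of_nonneg_right ?_ (pow_pos hQ _).le) (hf x)
      exact_mod_cast Finset.card_le_card fun k hk => by
        have : min (f k) a = x := by simpa using hk
        simp only [Finset.mem_filter, Finset.mem_univ, true_and]
        omega
    refine le_trans (mul_le_mul_of_nonneg_right h2 (by positivity)) (le_of_eq ?_)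
    have : Q ^ a = Q ^ x * Q ^ (a - x) := by rw [← pow_add]; congr 1; omega
    rw [this]
    field_simp
  refine (Finset.sum_le_sum hterm).trans (le_of_eq ?_)
  rw [← Finset.mul_sum]
  have h3 : ∑ x ∈ Finset.range (a + 1), (((a - x) + j).choose j : ℝ)
      = ((a + (j + 1)).choose (j + 1) : ℝ) := by
    have h4 := Finset.sum_range_reflect (fun x => ((x + j).choose j : ℝ)) (a + 1)
    simp only [Nat.add_sub_cancel] at h4
    rw [h4]
    exact_mod_cast Nat.sum_range_add_choose a j
  rw [h3]
  ring

end Counting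

/-! ### Random coefficients node by node, and the second bound -/

namespace Network

variable {V E : Type*} {G : Network V E}

/-- The channels are levelled by a topological numbering of the internal nodes they enter. -/
theorem exists_node_levels [Fintype V] : ∃ ℓ : E → ℕ,
    (∀ d e, G.Adj d e → ℓ d < ℓ e) ∧ (∀ e, G.head e ∈ G.sinks → ℓ e = G.internalNodes.ncard) ∧
    (∀ e, ℓ e ≤ G.internalNodes.ncard) ∧
    ∀ d e, ℓ d = ℓ e → ℓ d < G.internalNodes.ncard → G.head d = G.head e := by
  classical
  obtain ⟨τ, hinj, hlt, hmono⟩ := exists_topological_numbering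
    (fun a b : G.internalNodes => ∃ e, G.tail e = a ∧ G.head e = b)
    (fun a h => G.acyclic a (h.lift Subtype.val fun _ _ h => h))
  have hcard : Fintype.card G.internalNodes = G.internalNodes.ncard := by
    rw [Set.ncard_eq_toFinset_card', Set.toFinset_card]
  have hint : ∀ e, G.head e ∉ G.sinks → G.head e ∈ G.internalNodes :=
    fun e he => ⟨G.head_ne_source e, he⟩
  let ℓ : E → ℕ := fun e =>
    if he : G.head e ∈ G.sinks then G.internalNodes.ncard else τ ⟨G.head e, hint e he⟩
  have hs : ∀ e, G.head e ∈ G.sinks → ℓ e = G.internalNodes.ncard := fun e he => dif_pos he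
  have hn : ∀ e (he : G.head e ∉ G.sinks), ℓ e = τ ⟨G.head e, hint e he⟩ := fun e he => dif_neg he
  have hn' : ∀ e, G.head e ∉ G.sinks → ℓ e < G.internalNodes.ncard := fun e he => by
    rw [hn e he, ← hcard]; exact hlt _
  refine ⟨ℓ, ?_, hs, ?_, ?_⟩
  · intro d e h
    have hd : G.head d ∉ G.sinks := by
      rw [show G.head d = G.tail e from h]; exact G.tail_notMem_sinks e
    by_cases he : G.head e ∈ G.sinks
    · rw [hs e he]; exact hn' d hd
    · rw [hn d hd, hn e he]
      exact hmono _ _ ⟨e, h.symm, rfl⟩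
  · intro e
    by_cases he : G.head e ∈ G.sinks
    · exact (hs e he).le
    · exact (hn' e he).le
  · intro d e h hd
    have hd' : G.head d ∉ G.sinks := fun h' => hd.ne (hs d h')
    have he' : G.head e ∉ G.sinks := fun h' => (h ▸ hd).ne (hs e h')
    rw [hn d hd', hn e he'] at h
    exact congrArg Subtype.val (hinj h)

variable [Fintype E] {F : Type*} [Field F] {w : ℕ}

/-- Disjoint paths to `t`, of which `n` start at the source and the others start in a given
full-rank error pattern, moved forward along a levelling of the channels. -/
theorem exists_channel_linking {ℓ : E → ℕ} {m : ℕ} (hℓ : ∀ d e, G.Adj d e → ℓ d < ℓ e)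
    (hs : ∀ e, G.head e ∈ G.sinks → ℓ e = m) (hm : ∀ e, ℓ e ≤ m) {t : V} (ht : t ∈ G.sinks)
    {n : ℕ} {ρ : Finset E} (hρ : G.rank F w t ρ = ρ.card) (hn : n + ρ.card ≤ G.minCut t) :
    ∃ q : ℕ → Fin n ⊕ ρ → E, (∀ j ≤ m, Function.Injective (q j)) ∧
      (∀ j < m, ∀ a, q (j + 1) a = q j a ∨ ℓ (q j a) = j ∧ G.Adj (q j a) (q (j + 1) a)) ∧
      (∀ j ≤ m, ∀ a, j ≤ ℓ (q j a)) ∧ (∀ a, G.head (q m a) = t) ∧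
      (∀ i, G.tail (q 0 (Sum.inl i)) = G.source) ∧ ∀ e : ρ, q 0 (Sum.inr e) = e := by
  let A : Finset (Fin n ⊕ E) := (Finset.univ : Finset (Fin n)).disjSum ρ
  -- Level 0 holds the imaginary channels. After one step every front consists of real channels,
  -- whence the shift by one between `p` and `q`.
  let lvl : Fin n ⊕ E → ℕ := Sum.elim (fun _ => 0) (fun e => ℓ e + 1)
  obtain ⟨p, hp0, hpinj, hpstep, hplvl, hpL⟩ := exists_leveled_linking
    (fun u v : Fin n ⊕ E => ∃ e, v = Sum.inr e ∧ G.ExtAdj u e) A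
    {b | ∃ e, b = Sum.inr e ∧ G.head e = t} lvl (m + 1)
    (by
      rintro (i | d) _ ⟨e, rfl, h⟩
      · simp [lvl]
      · simpa [lvl] using hℓ d e h)
    (by rintro _ ⟨e, rfl, h⟩; simpa [lvl] using hs e (h ▸ ht))
    (by
      rintro (i | d)
      · simp [lvl]
      · simpa [lvl] using hm d)
    (card_le_of_separates ht hρ fun _ => by simpa using hn)
  let ι : Fin n ⊕ ρ → A := fun a => ⟨Sum.map id Subtype.val a, by rcases a with i | e <;> simp [A]⟩
  have hι : Function.Injective ι := fun a b h =>
    Sum.map_injective.mpr ⟨Function.injective_id, Subtype.val_injective⟩ (congrArg Subtype.val h)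
  have hex : ∀ j a, ∃ e, j ≤ m → p (j + 1) (ι a) = Sum.inr e := by
    intro j a
    by_cases hj : j ≤ m
    · have h := hplvl (j + 1) (ι a) (by omega)
      rcases h' : p (j + 1) (ι a) with i | e
      · rw [h'] at h
        simp [lvl] at h
      · exact ⟨e, fun _ => rfl⟩
    · obtain ⟨e, _⟩ := hpL (ι a)
      exact ⟨e, fun h => (hj h).elim⟩
  choose q hq using hex
  refine ⟨q, ?_, ?_, ?_, ?_, ?_, ?_⟩
  · intro j hj a b hab
    exact hι (hpinj (j + 1) (by rw [hq j a hj, hq j b hj, hab]))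
  · intro j hj a
    have h := hpstep (j + 1) (ι a)
    rw [hq j a hj.le, hq (j + 1) a hj] at h
    rcases h with h | ⟨h, e, he, hadj⟩
    · exact Or.inl (Sum.inr_injective h)
    · refine Or.inr ⟨by simpa [lvl] using h, ?_⟩
      rw [Sum.inr_injective he]
      exact hadj
  · intro j hj a
    have h := hplvl (j + 1) (ι a) (by omega)
    rw [hq j a hj] at h
    simpa [lvl] using h
  · intro a
    obtain ⟨e, he, het⟩ := hpL (ι a)
    rw [hq m a le_rfl] at he
    rw [Sum.inr_injective he, het]
  · intro i
    have h := hpstep 0 (ι (Sum.inl i))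
    rw [hp0, hq 0 _ (Nat.zero_le _)] at h
    rcases h with h | ⟨_, e, he, hadj⟩
    · simp [ι] at h
    · rw [Sum.inr_injective he]
      exact hadj
  · intro e
    have h := hpstep 0 (ι (Sum.inr e))
    rw [hp0, hq 0 _ (Nat.zero_le _)] at h
    rcases h with h | ⟨h, _⟩
    · exact Sum.inr_injective h
    · simp [lvl, ι] at h

/-- The rank of the rows of the channels `f a` in the decoding matrix. -/
noncomputable def Code.rowRank (C : G.Code F w) (t : V) {A : Type*} (f : A → E) : ℕ :=
  Module.finrank F (Submodule.span F (Set.range fun a => C.decodingMatrix t (Sum.inr (f a))))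

/-- The code with the coefficients of all channels of level `j` replaced by those of `k`. -/
noncomputable def Code.redraw (C : G.Code F w) (lvl : Fin w ⊕ E → ℕ) (j : ℕ)
    (k : Fin w ⊕ E → E → F) : G.Code F w :=
  ofCoef fun m => if lvl m = j then k m else C.coef m

omit [Fintype E] in
theorem Code.coef_redraw_of_ne (C : G.Code F w) {lvl : Fin w ⊕ E → ℕ} {j : ℕ}
    (k : Fin w ⊕ E → E → F) {m : Fin w ⊕ E} (h : lvl m ≠ j) :
    (C.redraw lvl j k).coef m = C.coef m := by
  classical
  funext e
  rw [redraw, coef_ofCoef, if_neg h]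
  split_ifs with h'
  · rfl
  · exact (C.coef_eq_zero h').symm

theorem Code.decodingMatrix_redraw_of_lt (C : G.Code F w) {lvl : Fin w ⊕ E → ℕ}
    (hlt : ∀ m e, G.ExtAdj m e → lvl m < lvl (Sum.inr e)) {j : ℕ} (k : Fin w ⊕ E → E → F) (t : V)
    {m : Fin w ⊕ E} (h : j < lvl m) :
    (C.redraw lvl j k).decodingMatrix t m = C.decodingMatrix t m :=
  decodingMatrix_congr _ _ lvl hlt (j + 1)
    (fun _ h => C.coef_redraw_of_ne k (by omega)) t m h

/-- A redrawn row is a random combination of the rows of the subsequent channels. -/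
theorem Code.decodingMatrix_redraw (C : G.Code F w) {lvl : Fin w ⊕ E → ℕ}
    (hlt : ∀ m e, G.ExtAdj m e → lvl m < lvl (Sum.inr e)) (k : Fin w ⊕ E → E → F) (t : V)
    {m : Fin w ⊕ E} (hm : ∀ e, G.head e = t → m ≠ Sum.inr e) (v : E → G.In t → F)
    (hv : ∀ e, G.ExtAdj m e → v e = C.decodingMatrix t (Sum.inr e))
    (hv' : ∀ e, ¬ G.ExtAdj m e → v e = 0) :
    (C.redraw lvl (lvl m) k).decodingMatrix t m = Fintype.linearCombination F v (k m) := by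
  classical
  rw [decodingMatrix_of_head_ne _ _ _ hm, Fintype.linearCombination_apply]
  refine Finset.sum_congr rfl fun e _ => ?_
  rw [redraw, coef_ofCoef, if_pos rfl]
  split_ifs with h
  · rw [hv e h]
    congr 1
    exact C.decodingMatrix_redraw_of_lt hlt k t (hlt _ _ h)
  · rw [hv' e h, smul_zero, zero_smul]

open Classical in
/-- Redrawing the coefficients at an internal node decreases the rank along a linking by `x` with
probability at most `(q - 1)⁻ˣ`. -/
theorem Code.card_rowRank_drop_mul_le [Fintype F] (C : G.Code F w) {lvl : Fin w ⊕ E → ℕ}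
    (hlt : ∀ m e, G.ExtAdj m e → lvl m < lvl (Sum.inr e)) {j : ℕ}
    (hhead : ∀ d e, lvl (Sum.inr d) = j → lvl (Sum.inr e) = j → G.head d = G.head e) {t : V}
    (ht : ∀ e, G.head e = t → lvl (Sum.inr e) ≠ j) {A : Type*} [Finite A] (f f' : A → E)
    (hf' : Function.Injective f') (hlvl : ∀ a, j < lvl (Sum.inr (f a)))
    (hstep : ∀ a, f a = f' a ∨ lvl (Sum.inr (f' a)) = j ∧ G.Adj (f' a) (f a)) (x : ℕ) :
    (Finset.univ.filter fun k => (C.redraw lvl j k).rowRank t f' + x ≤ C.rowRank t f).card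
      * (Fintype.card F - 1) ^ x ≤ Fintype.card (Fin w ⊕ E → E → F) := by
  -- Only channels leaving the common head node keep their rows, so the superfluous random
  -- coefficients contribute nothing.
  let v : E → G.In t → F := fun e =>
    if ∃ d, lvl (Sum.inr d) = j ∧ G.Adj d e then C.decodingMatrix t (Sum.inr e) else 0
  refine card_rank_drop_mul_le v (fun a => lvl (Sum.inr (f' a)) = j)
    (fun a => C.decodingMatrix t (Sum.inr (f a))) f ?_ (fun a => Sum.inr (f' a))
    (fun a b _ _ h => hf' (Sum.inr_injective h))
    (fun k a => (C.redraw lvl j k).decodingMatrix t (Sum.inr (f' a))) ?_ x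
  · intro a ha
    have hadj : G.Adj (f' a) (f a) := by
      rcases hstep a with h | h
      · have := hlvl a
        rw [h] at this
        omega
      · exact h.2
    exact (if_pos ⟨f' a, ha, hadj⟩).symm
  · intro k a
    split_ifs with ha
    · have hred := C.decodingMatrix_redraw hlt k t (m := Sum.inr (f' a)) (fun e he h =>
        ht e he (by rw [← h]; exact ha)) v (fun e he => if_pos ⟨f' a, ha, he⟩)
        (fun e he => if_neg ?_)
      · rw [ha] at hred
        exact hred
      · rintro ⟨d, hd, hde⟩
        exact he ((hhead _ _ ha hd).trans hde)
    · have h : f a = f' a := (hstep a).resolve_right fun h => ha h.1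
      rw [← h]
      exact C.decodingMatrix_redraw_of_lt hlt k t (hlvl a)

open Classical in
/-- Redrawing the coefficients of the message channels fails to separate the messages from an error
pattern with probability at most `(q - 1)⁻ᵃ`, where `a - 1` is the excess of the rank over
`w + |ρ|`. -/
theorem Code.card_not_separates_mul_le [Fintype F] (C : G.Code F w) {lvl : Fin w ⊕ E → ℕ}
    (hlt : ∀ m e, G.ExtAdj m e → lvl m < lvl (Sum.inr e)) (hmsg : ∀ i, lvl (Sum.inl i) = 0)
    (hpos : ∀ e, 0 < lvl (Sum.inr e)) {t : V} {n : ℕ} {ρ : Finset E} (q : Fin n ⊕ ρ → E)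
    (hq : ∀ i, G.tail (q (Sum.inl i)) = G.source) (hqρ : ∀ e : ρ, q (Sum.inr e) = e) {a : ℕ}
    (ha : a = 0 ∨ a + w + ρ.card ≤ C.rowRank t q + 1) :
    (Finset.univ.filter fun k => ¬ (C.redraw lvl 0 k).Separates t ρ).card
      * (Fintype.card F - 1) ^ a ≤ Fintype.card (Fin w ⊕ E → E → F) := by
  rcases ha with rfl | ha
  · rw [pow_zero, mul_one]
    exact Finset.card_le_univ _
  let v : E → G.In t → F := fun e =>
    if G.tail e = G.source then C.decodingMatrix t (Sum.inr e) else 0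
  -- The path channels leaving the source contribute at least `rowRank - |ρ| ≥ w + a - 1` dimensions
  -- modulo the error space, and failure requires just one nonzero relation among the `w` message
  -- rows.
  obtain ⟨κ, _, s, _, hmv, hind, hcard⟩ := exists_basis_modulo (F := F)
    (fun a => C.decodingMatrix t (Sum.inr (q a))) (fun a => a.isLeft)
  have hU : Submodule.span F ((fun a => C.decodingMatrix t (Sum.inr (q a))) ''
      {a | ¬ a.isLeft}) = C.errorSpace t ρ := by
    rw [errorSpace_eq_span]
    congr 1
    ext y
    constructor
    · rintro ⟨i | e, h, rfl⟩
      · simp at h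
      · exact ⟨e, by simp only [hqρ]⟩
    · rintro ⟨e, rfl⟩
      exact ⟨Sum.inr e, by simp, by simp only [hqρ]⟩
  rw [hU] at hind hcard
  have hUle := C.finrank_errorSpace_le t ρ
  change _ = C.rowRank t q at hcard
  have key := card_relations_mul_le v (C.errorSpace t ρ) (Sum.inl : Fin w → Fin w ⊕ E)
    Sum.inl_injective (q ∘ s) (fun c hc => hind c (by
      convert hc using 3 with i
      have : G.tail ((q ∘ s) i) = G.source := by
        have h := hmv i
        rcases hsi : s i with i' | e
        · rw [Function.comp_apply, hsi, hq]
        · simp [hsi] at h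
      exact (if_pos this).symm)) 1
    (Finset.univ.filter fun k => ¬ (C.redraw lvl 0 k).Separates t ρ) (by
      intro k hk
      have hk : ¬ (C.redraw lvl 0 k).Separates t ρ := by simpa using hk
      have hmsgrow : ∀ i, (C.redraw lvl 0 k).decodingMatrix t (Sum.inl i)
          = Fintype.linearCombination F v (k (Sum.inl i)) := fun i => by
        have h := C.decodingMatrix_redraw hlt k t (m := Sum.inl i) (fun _ _ => Sum.inl_ne_inr) v
          (fun e he => if_pos he) (fun e he => if_neg he)
        rwa [hmsg] at h
      have herr : (C.redraw lvl 0 k).errorSpace t ρ = C.errorSpace t ρ := by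
        rw [errorSpace_eq_span, errorSpace_eq_span]
        congr 2
        funext e
        exact C.decodingMatrix_redraw_of_lt hlt k t (hpos e)
      unfold Separates at hk
      push Not at hk
      obtain ⟨X, hX, hX0⟩ := hk
      rw [herr] at hX
      simp only [hmsgrow] at hX
      rw [Nat.one_le_iff_ne_zero, ← Nat.pos_iff_ne_zero, Module.finrank_pos_iff,
        Submodule.nontrivial_iff_ne_bot, Submodule.ne_bot_iff]
      exact ⟨X, hX, hX0⟩)
  rw [pow_one, Fintype.card_fin] at key
  rcases Nat.eq_zero_or_pos a with rfl | hapos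
  · rw [pow_zero, mul_one]
    exact Finset.card_le_univ _
  set bad := (Finset.univ.filter fun k => ¬ (C.redraw lvl 0 k).Separates t ρ).card
  have h1 : bad * (Fintype.card F - 1) ^ a * Fintype.card F ^ w
      ≤ Fintype.card (Fin w ⊕ E → E → F) * Fintype.card F ^ w := by
    calc bad * (Fintype.card F - 1) ^ a * Fintype.card F ^ w
        = bad * ((Fintype.card F - 1) * ((Fintype.card F - 1) ^ (a - 1) * Fintype.card F ^ w)) := by
          obtain ⟨b, rfl⟩ := Nat.exists_eq_succ_of_ne_zero hapos.ne'
          rw [Nat.succ_sub_one, pow_succ]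
          ring
      _ ≤ bad * ((Fintype.card F - 1) * (Fintype.card F ^ (a - 1) * Fintype.card F ^ w)) := by
          gcongr
          exact Nat.sub_le _ _
      _ ≤ bad * ((Fintype.card F - 1) * Fintype.card F ^ Fintype.card κ) := by
          rw [← pow_add]
          gcongr
          · exact Fintype.card_pos
          · omega
      _ ≤ _ := key
      _ ≤ _ := by
          rw [mul_comm]
          exact Nat.mul_le_mul_left _ (Nat.sub_le _ _)
  exact Nat.le_of_mul_le_mul_right h1 (pow_pos Fintype.card_pos _)

/-- The second field size bound. -/
theorem exists_code_of_sum_choose_lt [Fintype V] [Fintype F] {d : ℕ}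
    (hwC : ∀ t ∈ G.sinks, w ≤ G.minCut t) (hd : ∀ t ∈ G.sinks, d ≤ G.redundancy w t)
    (h : ∑ t ∈ G.sinks, ((G.fullRankPatterns F w t (G.redundancy w t - d)).ncard : ℝ)
          * ((d + G.internalNodes.ncard + 1).choose G.internalNodes.ncard : ℝ)
        < ((Fintype.card F : ℝ) - 1) ^ (d + 1)) :
    ∃ C : G.Code F w, ∀ t ∈ G.sinks, ∀ ρ ∈ G.fullRankPatterns F w t (G.redundancy w t - d),
      C.Separates t ρ := by
  classical
  obtain ⟨ℓ, hℓ, hs, hm, hhead⟩ := exists_node_levels (G := G)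
  set m := G.internalNodes.ncard with hmdef
  let I := Σ t : G.sinks, G.fullRankPatterns F w (t : V) (G.redundancy w t - d)
  let lvl : Fin w ⊕ E → ℕ := Sum.elim (fun _ => 0) (fun e => ℓ e + 1)
  have hlt : ∀ u e, G.ExtAdj u e → lvl u < lvl (Sum.inr e) := by
    rintro (i | c) e h
    · simp [lvl]
    · simpa [lvl] using hℓ c e h
  have hQ : (0 : ℝ) < (Fintype.card F : ℝ) - 1 := by
    have : 1 < Fintype.card F := Fintype.one_lt_card
    have : (1 : ℝ) < Fintype.card F := by exact_mod_cast this
    linarith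
  have hQcast : ((Fintype.card F - 1 : ℕ) : ℝ) = (Fintype.card F : ℝ) - 1 := by
    rw [Nat.cast_sub Fintype.card_pos, Nat.cast_one]
  set Q : ℝ := (Fintype.card F : ℝ) - 1 with hQdef
  have hcardρ : ∀ x : I, w + d + x.2.1.card = G.minCut x.1 := fun x => by
    have h1 := hwC x.1 x.1.2
    have h2 := hd x.1 x.1.2
    have h3 := x.2.2.1
    unfold redundancy at h2 h3
    omega
  have hlink := fun x : I => exists_channel_linking (F := F) (w := w) (n := w + d) hℓ hs hm x.1.2
    (x.2.2.2.trans x.2.2.1.symm) (hcardρ x).le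
  choose q hqinj hqstep hqlvl hqt hqs hqρ using hlink
  have hpot : ∑ _x : I, ((d + 1 + m).choose m : ℝ) / Q ^ (d + 1) < 1 := by
    rw [Finset.sum_const, nsmul_eq_mul, ← mul_div_assoc, div_lt_one (pow_pos hQ _)]
    refine lt_of_eq_of_lt ?_ h
    rw [Finset.card_univ, Fintype.card_sigma, ← Finset.sum_mul]
    congr 1
    · push_cast
      rw [← Finset.sum_coe_sort G.sinks]
      exact Finset.sum_congr rfl fun t _ => by
        rw [Set.ncard_eq_toFinset_card', Set.toFinset_card]
    · congr 2
      omega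
  -- Here `a x - 1` is a guaranteed excess of the rank over `w + |ρ|`, and `a x = 0` guarantees
  -- nothing. At the sinks the excess is `d`.
  have main : ∀ i j, j + i = m → ∃ (C : G.Code F w) (a : I → ℕ),
      (∀ x, a x = 0 ∨ a x + w + x.2.1.card ≤ C.rowRank x.1 (q x j) + 1) ∧
      ∑ x, ((a x + j).choose j : ℝ) / Q ^ a x < 1 := by
    intro i
    induction i with
    | zero =>
      intro j hj
      have hj : j = m := by omega
      subst hj
      refine ⟨Code.ofCoef 0, fun _ => d + 1, fun x => Or.inr ?_, hpot⟩
      have hind := (Code.ofCoef (G := G) (0 : Fin w ⊕ E → E → F)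
        ).linearIndependent_decodingMatrix_of_sink x.1.2 (q x m) (hqinj x m le_rfl) (hqt x)
      rw [Code.rowRank, finrank_span_eq_card hind, Fintype.card_sum, Fintype.card_fin,
        Fintype.card_coe]
      beta_reduce
      omega
    | succ i ih =>
      intro j hj
      obtain ⟨C, a, hrank, hsum⟩ := ih (j + 1) (by omega)
      let f : I → (Fin w ⊕ E → E → F) → ℕ := fun x k =>
        C.rowRank x.1 (q x (j + 1)) - (C.redraw lvl (j + 1) k).rowRank x.1 (q x j)
      have hdrop : ∀ x y, ((Finset.univ.filter fun k => y ≤ f x k).card : ℝ) * Q ^ y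
          ≤ Fintype.card (Fin w ⊕ E → E → F) := by
        intro x y
        -- The drop `f` is a truncated difference, so `y ≤ f x k` gives a genuine drop only for
        -- positive `y`.
        rcases Nat.eq_zero_or_pos y with rfl | hy
        · rw [pow_zero, mul_one]
          exact_mod_cast Finset.card_le_univ _
        have h1 := C.card_rowRank_drop_mul_le hlt (j := j + 1)
          (fun c e hc he => by
            have hc : ℓ c = j := by simpa [lvl] using hc
            have he : ℓ e = j := by simpa [lvl] using he
            exact hhead c e (by omega) (by omega))
          (t := x.1) (fun e he hl => by
            have h2 := hs e (he ▸ x.1.2)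
            have hl : ℓ e = j := by simpa [lvl] using hl
            omega) (q x (j + 1)) (q x j) (hqinj x j (by omega))
          (fun c => by
            have := hqlvl x (j + 1) (by omega) c
            simp only [lvl, Sum.elim_inr]
            omega)
          (fun c => by
            have := hqstep x j (by omega) c
            simpa [lvl] using this) y
        rw [← hQcast]
        have h2 : (Finset.univ.filter fun k => y ≤ f x k)
            ⊆ Finset.univ.filter fun k => (C.redraw lvl (j + 1) k).rowRank x.1 (q x j) + y
              ≤ C.rowRank x.1 (q x (j + 1)) := by
          intro k hk
          simp only [Finset.mem_filter, Finset.mem_univ, true_and, f] at hk ⊢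
          omega
        exact_mod_cast (Nat.mul_le_mul_right _ (Finset.card_le_card h2)).trans h1
      obtain ⟨k, _, hk⟩ : ∃ k ∈ (Finset.univ : Finset (Fin w ⊕ E → E → F)),
          ∑ x, (((a x - f x k) + j).choose j : ℝ) / Q ^ (a x - f x k)
            ≤ ∑ x, ((a x + (j + 1)).choose (j + 1) : ℝ) / Q ^ a x := by
        -- Some draw does no worse than the average, for all pairs summed together.
        refine Finset.exists_le_of_sum_le Finset.univ_nonempty ?_
        rw [Finset.sum_comm, Finset.sum_const, nsmul_eq_mul, Finset.mul_sum]
        refine Finset.sum_le_sum fun x _ => ?_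
        rw [Finset.card_univ]
        exact sum_potential_le (f x) Q hQ (hdrop x) j (a x)
      refine ⟨C.redraw lvl (j + 1) k, fun x => a x - f x k, fun x => ?_, hk.trans_lt hsum⟩
      have h1 := hrank x
      simp only [f]
      omega
  obtain ⟨C, a, hrank, hsum⟩ := main m 0 (by omega)
  have hbad : ∀ x : I, ((Finset.univ.filter fun k =>
      ¬ (C.redraw lvl 0 k).Separates x.1 x.2.1).card : ℝ)
      ≤ Fintype.card (Fin w ⊕ E → E → F) * (((a x + 0).choose 0 : ℝ) / Q ^ a x) := by
    intro x
    have h1 := C.card_not_separates_mul_le hlt (fun _ => rfl) (fun e => Nat.succ_pos _) (q x 0)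
      (hqs x) (hqρ x) (hrank x)
    rw [Nat.choose_zero_right, Nat.cast_one, mul_one_div, le_div_iff₀ (pow_pos hQ _), ← hQcast]
    exact_mod_cast h1
  have hlt_card : ((Finset.univ.biUnion fun x : I => Finset.univ.filter fun k =>
      ¬ (C.redraw lvl 0 k).Separates x.1 x.2.1).card : ℝ)
      < Fintype.card (Fin w ⊕ E → E → F) := by
    have hΩ : (0 : ℝ) < Fintype.card (Fin w ⊕ E → E → F) := by exact_mod_cast Fintype.card_pos
    calc _ ≤ ∑ x : I, ((Finset.univ.filter fun k =>
            ¬ (C.redraw lvl 0 k).Separates x.1 x.2.1).card : ℝ) := by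
          exact_mod_cast Finset.card_biUnion_le
      _ ≤ ∑ x, Fintype.card (Fin w ⊕ E → E → F) * (((a x + 0).choose 0 : ℝ) / Q ^ a x) :=
          Finset.sum_le_sum fun x _ => hbad x
      _ < _ := by
          rw [← Finset.mul_sum]
          exact mul_lt_of_lt_one_right hΩ hsum
  have hlt_card : (Finset.univ.biUnion fun x : I => Finset.univ.filter fun k =>
      ¬ (C.redraw lvl 0 k).Separates x.1 x.2.1).card
      < (Finset.univ : Finset (Fin w ⊕ E → E → F)).card := by
    rw [Finset.card_univ]
    exact_mod_cast hlt_card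
  obtain ⟨k, _, hk⟩ := Finset.exists_mem_notMem_of_card_lt_card hlt_card
  refine ⟨C.redraw lvl 0 k, fun t ht ρ hρ => ?_⟩
  by_contra hsep
  exact hk (Finset.mem_biUnion.mpr ⟨⟨⟨t, ht⟩, ⟨ρ, hρ⟩⟩, Finset.mem_univ _, by simpa using hsep⟩)

theorem ncard_fullRankPatterns_le (t : V) (n : ℕ) :
    (G.fullRankPatterns F w t n).ncard ≤ (Fintype.card E).choose n := by
  classical
  rw [← Finset.card_univ, ← Finset.card_powersetCard, ← Set.ncard_coe_finset]
  refine Set.ncard_le_ncard (fun ρ hρ => ?_) (Finset.finite_toSet _)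
  simpa using hρ.1

end Network

/-! ### The main theorem -/

open Network

theorem mainTheorem8 {V E F : Type*} [Fintype V] [Fintype E] [Field F] [Fintype F]
    (G : Network V E) (w d : ℕ) (hw : 1 ≤ w)
    (hwC : ∀ t ∈ G.sinks, w ≤ G.minCut t)
    (hd : ∀ t ∈ G.sinks, d ≤ G.redundancy w t) :
    ((Fintype.card F : ℝ) ≥
        min (∑ t ∈ G.sinks, ((G.fullRankPatterns F w t (G.redundancy w t - d)).ncard : ℝ))
          (2 + (∑ t ∈ G.sinks, ((G.fullRankPatterns F w t (G.redundancy w t - d)).ncard : ℝ)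
              * ((d + G.internalNodes.ncard + 1).choose G.internalNodes.ncard : ℝ))
            ^ (1 / ((d : ℝ) + 1))) →
      ∃ C : G.Code F w, C.IsRegular ∧ ∀ t ∈ G.sinks, C.degradation t ≤ d) ∧
    min (∑ t ∈ G.sinks, ((G.fullRankPatterns F w t (G.redundancy w t - d)).ncard : ℝ))
        (2 + (∑ t ∈ G.sinks, ((G.fullRankPatterns F w t (G.redundancy w t - d)).ncard : ℝ)
            * ((d + G.internalNodes.ncard + 1).choose G.internalNodes.ncard : ℝ))
          ^ (1 / ((d : ℝ) + 1)))
      ≤ 2 + (∑ t ∈ G.sinks, ((Fintype.card E).choose (G.redundancy w t - d) : ℝ)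
            * ((d + G.internalNodes.ncard + 1).choose G.internalNodes.ncard : ℝ))
          ^ (1 / ((d : ℝ) + 1)) := by
  have hroot : (1 / ((d : ℝ) + 1)) = ((d + 1 : ℕ) : ℝ)⁻¹ := by push_cast; rw [one_div]
  have hnonneg : 0 ≤ ∑ t ∈ G.sinks,
      ((G.fullRankPatterns F w t (G.redundancy w t - d)).ncard : ℝ)
        * ((d + G.internalNodes.ncard + 1).choose G.internalNodes.ncard : ℝ) :=
    Finset.sum_nonneg fun t _ => by positivity
  constructor
  · intro hF
    suffices ∃ C : G.Code F w, ∀ t ∈ G.sinks,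
        ∀ ρ ∈ G.fullRankPatterns F w t (G.redundancy w t - d), C.Separates t ρ by
      obtain ⟨C, hC⟩ := this
      exact ⟨C, C.isRegular_and_degradation_le hw hd hC⟩
    rcases min_le_iff.mp hF with h | h
    · exact exists_code_of_sum_fullRankPatterns_le hwC (by exact_mod_cast h)
    · refine exists_code_of_sum_choose_lt hwC hd ?_
      rw [hroot] at h
      set S := ∑ t ∈ G.sinks, ((G.fullRankPatterns F w t (G.redundancy w t - d)).ncard : ℝ)
        * ((d + G.internalNodes.ncard + 1).choose G.internalNodes.ncard : ℝ)
      have h1 : 0 ≤ S ^ ((d + 1 : ℕ) : ℝ)⁻¹ := Real.rpow_nonneg hnonneg _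
      -- The summand 2 makes `|F| - 1` exceed the root by at least 1, which gives the strict
      -- inequality.
      calc S = (S ^ ((d + 1 : ℕ) : ℝ)⁻¹) ^ (d + 1) :=
            (Real.rpow_inv_natCast_pow hnonneg (Nat.succ_ne_zero d)).symm
        _ < ((Fintype.card F : ℝ) - 1) ^ (d + 1) :=
            pow_lt_pow_left₀ (by linarith) h1 (Nat.succ_ne_zero d)
  · refine (min_le_right _ _).trans (add_le_add_right (Real.rpow_le_rpow hnonneg ?_ ?_) 2)
    · refine Finset.sum_le_sum fun t _ => mul_le_mul_of_nonneg_right ?_ (Nat.cast_nonneg _)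
      exact_mod_cast ncard_fullRankPatterns_le t _
    · positivity
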